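/- Setting. Let $n\ge 0$, $N=\mathbb Z^n$ with standard basis $e_1,\dots,e_n$, $M=\mathrm{Hom}(N,\mathbb Z)$ with dual basis $e_1^*,\dots,e_n^*$. Let $\Delta$ be a finite fan of rational strongly convex polyhedral cones in $N_{\mathbb R}$ that contains the cone generated by $e_1,\dots,e_n$ and all of whose maximal cones are generated by a $\mathbb Z$-basis of $N$. For $\sigma\in\Delta$ put $M_\sigma=\sigma^\vee\cap M$ (written multiplicatively) and $U_\sigma=\mathrm{Spec}\,\mathbb C[M_\sigma]$, and let $Y(\Delta)$ be the smooth toric variety glued from the $U_\sigma$. Let $\breve M$ be the edge-path monoid of $M$ with respect to $\{\pm e_i^*\}$, i.e. the free group on $e_1^*,\dots,e_n^*$, and $\pi:\breve M\to M$ the abelianization map. A submonoid $P\subset\breve M$ is admissible to $\sigma$ if it is finitely generated, $\pi(P)=M_\sigma$, and each $p\in P$ with $\pi(p)$ invertible in $M_\sigma$ is invertible in $P$. A soft noncommutative toric scheme $\breve Y(\Delta)$ (with smooth fundamental charts) is a family $\{\breve M_\sigma\}_{\sigma\in\Delta}$ of submonoids of $\breve M$, with $\breve M_\sigma$ admissible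 to $\sigma$, $\breve M_\sigma\subset\breve M_\tau$ for each face $\tau$ of $\sigma$, $\breve M_\sigma$ isomorphic to the free monoid on $n$ letters for each maximal $\sigma$, and $\breve M_{\mathbf 0}=\breve M$. Put $\breve R_\sigma=\mathbb C\langle\breve M_\sigma\rangle$ (monoid algebra). A softening of $\breve Y(\Delta)=\{\breve M_\sigma\}$ is a soft noncommutative toric scheme $\breve Y'(\Delta)=\{\breve M'_\sigma\}$ with $\breve M'_\sigma=\breve M_\sigma$ for maximal $\sigma$ and $\breve M_\sigma\subset\breve M'_\sigma$ for the other cones. An invertible (left) $\mathcal O_{\breve Y(\Delta)}$-module is a family of left $\breve R_\sigma$-modules $\breve F_\sigma\simeq\breve R_\sigma$ with isomorphisms $h_{\sigma\tau}:\breve R_\tau\otimes_{\breve R_\sigma}\breve F_\sigma\to\breve F_\tau$ of left $\breve R_\tau$-modules, for proper faces $\tau\prec\sigma$, such that $h_{\tau\rho}\circ(\breve R_\rho\otimes h_{\sigma\tau})=h_{\sigma\rho}$ for $\rho\prec\tau\prec\sigma$. It extends an invertible $\mathcal O_{Y(\Delta)}$-module $\mathcal L$ if its restriction to $Y(\Delta)$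 is isomorphic to $\mathcal L$, i.e. if there are $\mathbb C[M_\sigma]$-linear isomorphisms $\mathbb C[M_\sigma]\otimes_{\breve R_\sigma}\breve F_\sigma\simeq\mathcal L(U_\sigma)$ (via $\pi:\breve R_\sigma\to\mathbb C[M_\sigma]$), for $\sigma\in\Delta$, that carry the maps induced by the $h_{\sigma\tau}$ to the restriction maps of $\mathcal L$. Proposition 3.5 (existence of invertible sheaf after passing to softening). Let $\mathcal L$ be an invertible $\mathcal O_{Y(\Delta)}$-module on $Y(\Delta)$. Then for every soft noncommutative toric scheme $\breve Y(\Delta)$ associated to $\Delta$ there exists a softening $\breve Y'(\Delta)\to\breve Y(\Delta)$ such that $\mathcal L$ extends to an invertible $\mathcal O_{\breve Y'(\Delta)}$-module. Proposition 3.5$'$. In particular, there exists a soft noncommutative toric scheme $\breve Y(\Delta)$ associated to $\Delta$ such that $\mathcal L$ extends to an invertible $\mathcal O_{\breve Y(\Delta)}$-module. -/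

import Mathlib

open CategoryTheory CategoryTheory.Limits AlgebraicGeometry
open scoped TensorProduct

noncomputable section

namespace SoftToric

/-! ### Fans in `N = ℤⁿ` -/

/-- The inclusion of the lattice `N = ℤⁿ` into `N_ℝ = ℝⁿ`. -/
def latticeVec {n : ℕ} (v : Fin n → ℤ) : Fin n → ℝ := fun i => (v i : ℝ)

/-- The evaluation pairing of `M = Hom(N, ℤ)` with `N_ℝ`, where `m : Fin n → ℤ` stands for
`∑ mᵢ eᵢ*`. -/
def pairing {n : ℕ} (m : Fin n → ℤ) (v : Fin n → ℝ) : ℝ := ∑ i, (m i : ℝ) * v i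

/-- A (finite) fan in `N = ℤⁿ`: a set of rational strongly convex polyhedral cones in `N_ℝ`, closed
under passing to faces, any two of whose members meet in a common face. -/
structure Fan (n : ℕ) where
  cones : Set (PointedCone ℝ (Fin n → ℝ))
  finite : cones.Finite
  rational : ∀ σ ∈ cones, ∃ S : Finset (Fin n → ℤ),
    σ = PointedCone.hull ℝ (latticeVec '' (S : Set (Fin n → ℤ)))
  stronglyConvex : ∀ σ ∈ cones, ∀ v ∈ σ, -v ∈ σ → v = 0
  face_mem : ∀ σ ∈ cones, ∀ τ : PointedCone ℝ (Fin n → ℝ), τ.IsFaceOf σ → τ ∈ cones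
  inter_face : ∀ σ ∈ cones, ∀ τ ∈ cones, (σ ⊓ τ).IsFaceOf σ ∧ (σ ⊓ τ).IsFaceOf τ

/-- The standing assumption on the fan: the cone generated by the standard basis `e₁, …, eₙ`
of `N` belongs to the fan, and every maximal cone is `n`-dimensional, simplicial and of index `1`,
i.e. it is generated by a `ℤ`-basis of `N`. -/
structure SmoothFan (n : ℕ) extends Fan n where
  reference : PointedCone.hull ℝ
    (Set.range fun i : Fin n => latticeVec (Pi.single i 1 : Fin n → ℤ)) ∈ cones
  smooth : ∀ σ : PointedCone ℝ (Fin n → ℝ), Maximal (· ∈ cones) σ →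
    ∃ b : Module.Basis (Fin n) ℤ (Fin n → ℤ),
      σ = PointedCone.hull ℝ (Set.range fun i => latticeVec (b i))

variable {n : ℕ}

/-- The type of cones of `Δ`, ordered by inclusion. For cones of a fan, `τ ≤ σ` if and only if `τ`
is a face of `σ`, see `SmoothFan.le_iff_isFaceOf`. -/
abbrev SmoothFan.Cone (Δ : SmoothFan n) : Type := {σ : PointedCone ℝ (Fin n → ℝ) // σ ∈ Δ.cones}

theorem SmoothFan.le_iff_isFaceOf (Δ : SmoothFan n) (τ σ : Δ.Cone) :
    τ ≤ σ ↔ τ.1.IsFaceOf σ.1 := by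
  refine ⟨fun h => ?_, fun h => h.le⟩
  have := (Δ.inter_face τ.1 τ.2 σ.1 σ.2).2
  rwa [inf_eq_left.mpr (show τ.1 ≤ σ.1 from h)] at this

/-- The lattice `M = Hom(N, ℤ)` of characters, written multiplicatively. -/
abbrev CharLattice (n : ℕ) : Type := Multiplicative (Fin n → ℤ)

theorem pairing_add_left (m m' : Fin n → ℤ) (v : Fin n → ℝ) :
    pairing (m + m') v = pairing m v + pairing m' v := by
  simp [pairing, add_mul, Finset.sum_add_distrib]

theorem pairing_nsmul_left (k : ℕ) (m : Fin n → ℤ) (v : Fin n → ℝ) :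
    pairing (k • m) v = k * pairing m v := by
  simp [pairing, Finset.mul_sum, mul_assoc]

theorem pairing_neg_left (m : Fin n → ℤ) (v : Fin n → ℝ) :
    pairing (-m) v = -pairing m v := by
  simp [pairing]

theorem pairing_add_right (m : Fin n → ℤ) (v w : Fin n → ℝ) :
    pairing m (v + w) = pairing m v + pairing m w := by
  simp [pairing, mul_add, Finset.sum_add_distrib]

theorem pairing_smul_right (m : Fin n → ℤ) (a : ℝ) (v : Fin n → ℝ) :
    pairing m (a • v) = a * pairing m v := by
  simp only [pairing, Pi.smul_apply, smul_eq_mul, Finset.mul_sum]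
  exact Finset.sum_congr rfl fun i _ => by ring

theorem pairing_zero_right (m : Fin n → ℤ) : pairing m 0 = 0 := by
  simp [pairing]

theorem pairing_latticeVec (m v : Fin n → ℤ) :
    pairing m (latticeVec v) = ((∑ i, m i * v i : ℤ) : ℝ) := by
  simp [pairing, latticeVec]

/-- The commutative monoid `M_σ = σ^∨ ∩ M`, as a submonoid of `M` written multiplicatively. -/
def dualMonoid (σ : PointedCone ℝ (Fin n → ℝ)) : Submonoid (CharLattice n) where
  carrier := {m | ∀ v ∈ σ, 0 ≤ pairing m.toAdd v}
  one_mem' := fun v _ => by simp [pairing]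
  mul_mem' := fun {a b} ha hb v hv => by
    simpa [pairing_add_left] using add_nonneg (ha v hv) (hb v hv)

theorem dualMonoid_anti {σ τ : PointedCone ℝ (Fin n → ℝ)} (h : τ ≤ σ) :
    dualMonoid σ ≤ dualMonoid τ :=
  fun _ hm v hv => hm v (h hv)

/-! ### The toric variety `Y(Δ)` -/

/-- The coordinate ring `ℂ[M_σ]` of the affine toric variety `U_σ`. -/
abbrev coordRing (σ : PointedCone ℝ (Fin n → ℝ)) : Type := MonoidAlgebra ℂ (dualMonoid σ)

/-- The inclusion `ℂ[M_σ] → ℂ[M_τ]` for `τ ≤ σ`. -/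
def coordRes {σ τ : PointedCone ℝ (Fin n → ℝ)} (h : τ ≤ σ) : coordRing σ →+* coordRing τ :=
  MonoidAlgebra.mapDomainRingHom ℂ (Submonoid.inclusion (dualMonoid_anti h))

theorem coordRes_refl (σ : PointedCone ℝ (Fin n → ℝ)) :
    coordRes (le_refl σ) = RingHom.id (coordRing σ) :=
  MonoidAlgebra.mapDomainRingHom_id ..

theorem coordRes_comp {σ τ ρ : PointedCone ℝ (Fin n → ℝ)} (h : τ ≤ σ) (h' : ρ ≤ τ) :
    (coordRes h').comp (coordRes h) = coordRes (h'.trans h) :=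
  (MonoidAlgebra.mapDomainRingHom_comp ..).symm

/-- The `Δ`-system of affine schemes `U_σ = Spec ℂ[M_σ]`. -/
def SmoothFan.charts (Δ : SmoothFan n) : Δ.Cone ⥤ Scheme.{0} where
  obj σ := Spec (CommRingCat.of (coordRing σ.1))
  map f := Spec.map (CommRingCat.ofHom (coordRes f.le))
  map_id σ := by
    rw [← Spec.map_id]; congr 1
    exact congrArg CommRingCat.ofHom (coordRes_refl σ.1)
  map_comp f g := by
    rw [← Spec.map_comp]; congr 1
    exact congrArg CommRingCat.ofHom (coordRes_comp (leOfHom g) (leOfHom f)).symm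

/-- `u` cuts out `τ` inside `σ`: it is nonnegative on `σ` and `τ = σ ∩ u^⊥`. -/
def CutsOut (u : Fin n → ℤ) (τ σ : PointedCone ℝ (Fin n → ℝ)) : Prop :=
  (∀ v ∈ σ, 0 ≤ pairing u v) ∧ ∀ v ∈ σ, v ∈ τ ↔ pairing u v = 0

theorem CutsOut.inf {u u' : Fin n → ℤ} {τ τ' σ : PointedCone ℝ (Fin n → ℝ)}
    (h : CutsOut u τ σ) (h' : CutsOut u' τ' σ) : CutsOut (u + u') (τ ⊓ τ') σ := by
  refine ⟨fun v hv => ?_, fun v hv => ?_⟩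
  · rw [pairing_add_left]; exact add_nonneg (h.1 v hv) (h'.1 v hv)
  · rw [pairing_add_left, Submodule.mem_inf, h.2 v hv, h'.2 v hv,
      add_eq_zero_iff_of_nonneg (h.1 v hv) (h'.1 v hv)]

theorem pairing_nonneg_of_mem_hull {S : Set (Fin n → ℝ)} {m : Fin n → ℤ}
    (h : ∀ s ∈ S, 0 ≤ pairing m s) {v : Fin n → ℝ} (hv : v ∈ PointedCone.hull ℝ S) :
    0 ≤ pairing m v := by
  induction hv using Submodule.span_induction with
  | mem x hx => exact h x hx
  | zero => rw [pairing_zero_right]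
  | add x y _ _ hx hy => rw [pairing_add_right]; exact add_nonneg hx hy
  | smul a x _ hx =>
    have : pairing m (a • x) = a.1 * pairing m x := pairing_smul_right m a.1 x
    rw [this]; exact mul_nonneg a.2 hx

theorem exists_nsmul_add_mem {u : Fin n → ℤ} {τ σ : PointedCone ℝ (Fin n → ℝ)}
    (hu : CutsOut u τ σ) {S : Finset (Fin n → ℤ)}
    (hS : σ = PointedCone.hull ℝ (latticeVec '' (S : Set (Fin n → ℤ))))
    {m : Fin n → ℤ} (hm : ∀ v ∈ τ, 0 ≤ pairing m v) :
    ∃ k : ℕ, ∀ v ∈ σ, 0 ≤ pairing (m + k • u) v := by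
  refine ⟨∑ s ∈ S, (∑ i, m i * s i).natAbs, fun v hv => ?_⟩
  rw [hS] at hv
  refine pairing_nonneg_of_mem_hull ?_ hv
  rintro _ ⟨s, hs, rfl⟩
  have hsσ : latticeVec s ∈ σ := by
    rw [hS]; exact Submodule.subset_span ⟨s, hs, rfl⟩
  have h0 := hu.1 _ hsσ
  rw [pairing_add_left, pairing_nsmul_left]
  rcases h0.eq_or_lt with h | h
  · rw [← h, mul_zero, add_zero]
    exact hm _ ((hu.2 _ hsσ).2 h.symm)
  · rw [pairing_latticeVec] at h ⊢
    rw [pairing_latticeVec]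
    have h1 : (1 : ℤ) ≤ ∑ i, u i * s i := by exact_mod_cast h
    have h2 : (∑ i, m i * s i).natAbs ≤ ∑ s ∈ S, (∑ i, m i * s i).natAbs :=
      Finset.single_le_sum (f := fun s => (∑ i, m i * s i).natAbs) (fun _ _ => Nat.zero_le _) hs
    have h3 : (0 : ℤ) ≤ (∑ i, m i * s i) +
        ((∑ s ∈ S, (∑ i, m i * s i).natAbs : ℕ) : ℤ) * ∑ i, u i * s i := by
      set K := ∑ s ∈ S, (∑ i, m i * s i).natAbs
      have h4 : ((∑ i, m i * s i).natAbs : ℤ) ≤ K := by exact_mod_cast h2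
      have h5 : -(∑ i, m i * s i) ≤ ((∑ i, m i * s i).natAbs : ℤ) := by omega
      nlinarith
    have h6 : (0 : ℝ) ≤ (((∑ i, m i * s i) +
        ((∑ s ∈ S, (∑ i, m i * s i).natAbs : ℕ) : ℤ) * ∑ i, u i * s i : ℤ) : ℝ) :=
      Int.cast_nonneg h3
    rw [Int.cast_add, Int.cast_mul, Int.cast_natCast] at h6
    exact h6

/-- Every face of a cone of a smooth fan is cut out by an integral functional. -/
theorem SmoothFan.exists_cutsOut (Δ : SmoothFan n) {τ σ : Δ.Cone} (h : τ ≤ σ) :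
    ∃ u : Fin n → ℤ, CutsOut u τ.1 σ.1 := by
  classical
  obtain ⟨μ, hσμ, hμ⟩ := Δ.finite.exists_le_maximal σ.2
  obtain ⟨b, hb⟩ := Δ.smooth μ hμ
  have hτμ : τ.1.IsFaceOf μ := (Δ.le_iff_isFaceOf τ ⟨μ, hμ.prop⟩).1 (le_trans h hσμ)
  let ℓ : (Fin n → ℤ) →ₗ[ℤ] ℤ := ∑ i with latticeVec (b i) ∉ τ.1, b.coord i
  let u : Fin n → ℤ := fun k => ℓ (Pi.single k 1)
  have hpair : ∀ w : Fin n → ℤ, pairing u (latticeVec w) = (ℓ w : ℝ) := by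
    intro w
    rw [pairing_latticeVec]
    congr 1
    conv_rhs => rw [LinearMap.pi_apply_eq_sum_univ ℓ w]
    exact Finset.sum_congr rfl fun i _ => by
      simp only [u, smul_eq_mul]; rw [mul_comm]; congr 2
      ext j; simp [Pi.single_apply, eq_comm]
  have hub : ∀ i, pairing u (latticeVec (b i)) = if latticeVec (b i) ∈ τ.1 then 0 else 1 := by
    intro i
    rw [hpair]
    simp only [ℓ, LinearMap.sum_apply, Module.Basis.coord_apply, Module.Basis.repr_self]
    simp [Finsupp.single_apply, Finset.sum_ite_eq]
  have hnn : ∀ v ∈ μ, 0 ≤ pairing u v := by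
    intro v hv
    rw [hb] at hv
    refine pairing_nonneg_of_mem_hull ?_ hv
    rintro _ ⟨i, rfl⟩
    rw [hub]; split_ifs <;> norm_num
  have hμτ : ∀ v ∈ μ, v ∈ τ.1 ↔ pairing u v = 0 := by
    intro v hv
    have hv' := hv
    rw [hb] at hv'
    obtain ⟨c, rfl⟩ := (Submodule.mem_span_range_iff_exists_fun _).1 hv'
    have hbi : ∀ i, latticeVec (b i) ∈ μ := fun i => by
      rw [hb]; exact Submodule.subset_span ⟨i, rfl⟩
    have hsum : pairing u (∑ i, c i • latticeVec (b i)) =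
        ∑ i, (c i : ℝ) * pairing u (latticeVec (b i)) := by
      let P : (Fin n → ℝ) →+ ℝ :=
        ⟨⟨pairing u, pairing_zero_right u⟩, pairing_add_right u⟩
      have := map_sum P (fun i => c i • latticeVec (b i)) Finset.univ
      refine this.trans (Finset.sum_congr rfl fun i _ => ?_)
      exact pairing_smul_right u (c i).1 _
    constructor
    · intro hvτ
      rw [hsum]
      refine Finset.sum_eq_zero fun i _ => ?_
      rw [hub]
      split_ifs with hi
      · simp
      · by_cases hc : c i = 0
        · simp [hc]
        · exfalso
          apply hi
          have hmem : (c i).1 • latticeVec (b i) + ∑ j ∈ Finset.univ.erase i,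
              c j • latticeVec (b j) ∈ τ.1 := by
            have := Finset.add_sum_erase Finset.univ (fun j => c j • latticeVec (b j))
              (Finset.mem_univ i)
            change c i • latticeVec (b i) + _ ∈ τ.1
            rw [this]; exact hvτ
          exact hτμ.mem_of_smul_add_mem (hbi i)
            (Submodule.sum_mem _ fun j _ => Submodule.smul_mem _ _ (hbi j))
            (lt_of_le_of_ne (c i).2 fun h => hc (Subtype.ext h.symm)) hmem
    · intro h0
      rw [hsum, Finset.sum_eq_zero_iff_of_nonneg] at h0
      · refine Submodule.sum_mem _ fun i _ => ?_
        by_cases hi : latticeVec (b i) ∈ τ.1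
        · exact Submodule.smul_mem _ _ hi
        · have := h0 i (Finset.mem_univ i)
          rw [hub, if_neg hi, mul_one] at this
          have hc : c i = 0 := Subtype.ext this
          rw [hc, zero_smul]; exact zero_mem _
      · intro i _
        exact mul_nonneg (c i).2 (hnn _ (hbi i))
  exact ⟨u, fun v hv => hnn v (hσμ hv), fun v hv => hμτ v (hσμ hv)⟩

/-- If `u` cuts out `τ` in `σ`, then `ℂ[M_τ]` is the localization of `ℂ[M_σ]` at the
character `u`. -/
theorem isLocalization_coordRing {u : Fin n → ℤ} {τ σ : PointedCone ℝ (Fin n → ℝ)}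
    (h : τ ≤ σ) (hu : CutsOut u τ σ) {S : Finset (Fin n → ℤ)}
    (hS : σ = PointedCone.hull ℝ (latticeVec '' (S : Set (Fin n → ℤ)))) :
    letI := (coordRes h).toAlgebra
    IsLocalization.Away (MonoidAlgebra.of ℂ (dualMonoid σ) ⟨Multiplicative.ofAdd u, hu.1⟩)
      (coordRing τ) := by
  let := (coordRes h).toAlgebra
  set x := MonoidAlgebra.of ℂ (dualMonoid σ) ⟨Multiplicative.ofAdd u, hu.1⟩ with hx
  have hmap : ∀ m : dualMonoid σ, coordRes h (MonoidAlgebra.of ℂ _ m) =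
      MonoidAlgebra.of ℂ _ (Submonoid.inclusion (dualMonoid_anti h) m) := fun m => by
    simp [coordRes]
  have hneg : Multiplicative.ofAdd (-u) ∈ dualMonoid τ := fun v hv => by
    change 0 ≤ pairing (-u) v
    rw [pairing_neg_left, (hu.2 v (h hv)).1 hv, neg_zero]
  have hunit : IsUnit (algebraMap (coordRing σ) (coordRing τ) x) := by
    change IsUnit (coordRes h x)
    rw [hx, hmap]
    refine IsUnit.of_mul_eq_one (MonoidAlgebra.of ℂ _ ⟨_, hneg⟩) ?_
    rw [← map_mul, ← map_one (MonoidAlgebra.of ℂ (dualMonoid τ))]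
    congr 1
    exact Subtype.ext (mul_inv_cancel (Multiplicative.ofAdd u))
  have hsurj : ∀ z : coordRing τ, ∃ (k : ℕ) (y : coordRing σ),
      z * coordRes h x ^ k = coordRes h y := by
    intro z
    induction z using MonoidAlgebra.induction_on with
    | of m =>
      obtain ⟨k, hk⟩ := exists_nsmul_add_mem hu hS (m := m.1.toAdd) m.2
      refine ⟨k, MonoidAlgebra.of ℂ _ ⟨Multiplicative.ofAdd (m.1.toAdd + k • u), hk⟩, ?_⟩
      rw [hx, hmap, hmap, ← map_pow, ← map_mul]
      congr 1
    | add a b ha hb =>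
      obtain ⟨k, y, hy⟩ := ha
      obtain ⟨l, y', hy'⟩ := hb
      refine ⟨k + l, y * x ^ l + y' * x ^ k, ?_⟩
      rw [map_add, map_mul, map_mul, map_pow, map_pow, ← hy, ← hy']; ring
    | smul r a ha =>
      obtain ⟨k, y, hy⟩ := ha
      refine ⟨k, r • y, ?_⟩
      have hr : coordRes h (r • y) = r • coordRes h y :=
        map_smul (MonoidAlgebra.mapDomainAlgHom ℂ ℂ
          (Submonoid.inclusion (dualMonoid_anti h))) r y
      rw [hr, ← hy, smul_mul_assoc]
  have hinj : Function.Injective (coordRes h) :=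
    MonoidAlgebra.mapDomain_injective (Submonoid.inclusion_injective (dualMonoid_anti h))
  refine ⟨?_, ?_, ?_⟩
  · rintro ⟨_, k, rfl⟩
    change IsUnit (algebraMap _ _ (x ^ k))
    rw [map_pow]; exact hunit.pow k
  · intro z
    obtain ⟨k, y, hy⟩ := hsurj z
    refine ⟨⟨y, ⟨x ^ k, k, rfl⟩⟩, ?_⟩
    change z * coordRes h (x ^ k) = coordRes h y
    rw [map_pow, hy]
  · intro a b hab
    exact ⟨1, by rw [hinj hab]⟩

theorem SmoothFan.isOpenImmersion_aux (Δ : SmoothFan n) {τ σ : Δ.Cone} (f : τ ⟶ σ) :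
    IsOpenImmersion (Δ.charts.map f) := by
  obtain ⟨u, hu⟩ := Δ.exists_cutsOut (leOfHom f)
  obtain ⟨S, hS⟩ := Δ.rational _ σ.2
  let := (coordRes (leOfHom f)).toAlgebra
  have := isLocalization_coordRing (leOfHom f) hu hS
  exact IsOpenImmersion.of_isLocalization
    (MonoidAlgebra.of ℂ (dualMonoid σ.1) ⟨Multiplicative.ofAdd u, hu.1⟩)

instance (Δ : SmoothFan n) {τ σ : Δ.Cone} (f : τ ⟶ σ) : IsOpenImmersion (Δ.charts.map f) :=
  Δ.isOpenImmersion_aux f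

theorem SmoothFan.range_charts_map (Δ : SmoothFan n) {τ σ : Δ.Cone} (f : τ ⟶ σ) {u : Fin n → ℤ}
    (hu : CutsOut u τ.1 σ.1) :
    Set.range (Δ.charts.map f) =
      (PrimeSpectrum.basicOpen (R := coordRing σ.1)
        (MonoidAlgebra.of ℂ (dualMonoid σ.1) ⟨Multiplicative.ofAdd u, hu.1⟩) :
          Set (PrimeSpectrum (coordRing σ.1))) := by
  obtain ⟨S, hS⟩ := Δ.rational _ σ.2
  let := (coordRes (leOfHom f)).toAlgebra
  have := isLocalization_coordRing (leOfHom f) hu hS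
  exact PrimeSpectrum.localization_away_comap_range (coordRing τ.1)
    (MonoidAlgebra.of ℂ (dualMonoid σ.1) ⟨Multiplicative.ofAdd u, hu.1⟩)

instance (Δ : SmoothFan n) : (Δ.charts ⋙ Scheme.forget).IsLocallyDirected where
  cond {i j k} fi fj xi xj hx := by
    obtain ⟨ui, hui⟩ := Δ.exists_cutsOut (leOfHom fi)
    obtain ⟨uj, huj⟩ := Δ.exists_cutsOut (leOfHom fj)
    let l : Δ.Cone := ⟨i.1 ⊓ j.1, Δ.face_mem _ i.2 _ (Δ.inter_face _ i.2 _ j.2).1⟩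
    let gi : l ⟶ i := homOfLE (show i.1 ⊓ j.1 ≤ i.1 from inf_le_left)
    let gj : l ⟶ j := homOfLE (show i.1 ⊓ j.1 ≤ j.1 from inf_le_right)
    have hx' : Δ.charts.map fi xi = Δ.charts.map fj xj := hx
    have h1 : Δ.charts.map fi xi ∈ Set.range (Δ.charts.map fi) := ⟨xi, rfl⟩
    have h2 : Δ.charts.map fi xi ∈ Set.range (Δ.charts.map fj) := ⟨xj, hx'.symm⟩
    have h3 : Δ.charts.map fi xi ∈ Set.range (Δ.charts.map (gi ≫ fi)) := by
      rw [Δ.range_charts_map fi hui] at h1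
      rw [Δ.range_charts_map fj huj] at h2
      rw [Δ.range_charts_map (gi ≫ fi) (hui.inf huj)]
      have he : MonoidAlgebra.of ℂ (dualMonoid k.1)
            ⟨Multiplicative.ofAdd (ui + uj), (hui.inf huj).1⟩ =
          MonoidAlgebra.of ℂ (dualMonoid k.1) ⟨Multiplicative.ofAdd ui, hui.1⟩ *
            MonoidAlgebra.of ℂ (dualMonoid k.1) ⟨Multiplicative.ofAdd uj, huj.1⟩ := by
        rw [← map_mul]; rfl
      rw [he, PrimeSpectrum.basicOpen_mul]
      exact ⟨h1, h2⟩
    obtain ⟨z, hz⟩ := h3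
    refine ⟨l, gi, gj, z, ?_, ?_⟩
    · apply (Δ.charts.map fi).isOpenEmbedding.injective
      change (Δ.charts.map fi) ((Δ.charts.map gi) z) = _
      rw [← hz, Functor.map_comp]; rfl
    · apply (Δ.charts.map fj).isOpenEmbedding.injective
      change (Δ.charts.map fj) ((Δ.charts.map gj) z) = (Δ.charts.map fj) xj
      rw [← hx', ← hz, ← Scheme.Hom.comp_apply, ← Functor.map_comp]; rfl

/-- The toric variety `Y(Δ)`: the scheme glued from the affine toric varieties `U_σ = Spec ℂ[M_σ]`,
`σ ∈ Δ`, along the open immersions `U_τ ⟶ U_σ` for `τ` a face of `σ`. -/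
def SmoothFan.toricVariety (Δ : SmoothFan n) : Scheme.{0} := colimit Δ.charts

/-- The open immersion `U_σ ⟶ Y(Δ)`. -/
def SmoothFan.chart (Δ : SmoothFan n) (σ : Δ.Cone) :
    Spec (CommRingCat.of (coordRing σ.1)) ⟶ Δ.toricVariety :=
  colimit.ι Δ.charts σ

instance (Δ : SmoothFan n) (σ : Δ.Cone) : IsOpenImmersion (Δ.chart σ) :=
  inferInstanceAs (IsOpenImmersion (colimit.ι Δ.charts σ))

theorem SmoothFan.map_chart (Δ : SmoothFan n) {τ σ : Δ.Cone} (f : τ ⟶ σ) :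
    Δ.charts.map f ≫ Δ.chart σ = Δ.chart τ :=
  colimit.w Δ.charts f

theorem SmoothFan.chart_image_le (Δ : SmoothFan n) {τ σ : Δ.Cone} (h : τ ≤ σ) :
    (Δ.chart τ ''ᵁ ⊤) ≤ (Δ.chart σ ''ᵁ ⊤) := by
  rintro _ ⟨x, -, rfl⟩
  refine ⟨Δ.charts.map (homOfLE h) x, trivial, ?_⟩
  rw [← Δ.map_chart (homOfLE h)]; rfl

/-- An invertible `𝒪_X`-module on a scheme: a sheaf of `𝒪_X`-modules that is locally isomorphic
to `𝒪_X`. -/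
def IsInvertibleSheaf {X : Scheme.{0}} (L : X.Modules) : Prop :=
  ∀ x : X, ∃ U : X.Opens, x ∈ U ∧
    Nonempty (L.restrict U.ι ≅ (SheafOfModules.unit U.toScheme.ringCatSheaf :
      U.toScheme.Modules))

/-- The `ℂ[M_σ]`-module `L(U_σ)` of sections of `L` over `U_σ ⊆ Y(Δ)`. -/
abbrev chartSections {Δ : SmoothFan n} (L : Δ.toricVariety.Modules) (σ : Δ.Cone) : Type :=
  Γ(L.restrict (Δ.chart σ), ⊤)

/-- Mathlib's `R`-module structure on the global sections of a sheaf of modules on `Spec R`. -/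
abbrev specSectionsModule (R : CommRingCat.{0}) (F : (Spec R).Modules) : Module R Γ(F, ⊤) :=
  inferInstance

instance {Δ : SmoothFan n} (L : Δ.toricVariety.Modules) (σ : Δ.Cone) :
    Module (coordRing σ.1) (chartSections L σ) :=
  specSectionsModule (CommRingCat.of (coordRing σ.1)) (L.restrict (Δ.chart σ))

/-- The restriction map `L(U_σ) → L(U_τ)` of the sheaf `L`, for `τ ≤ σ`. -/
def chartRestrict {Δ : SmoothFan n} (L : Δ.toricVariety.Modules) {τ σ : Δ.Cone} (h : τ ≤ σ) :
    chartSections L σ →+ chartSections L τ :=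
  ((L.restrictAppIso (Δ.chart σ) ⊤).hom ≫
    L.presheaf.map (homOfLE (Δ.chart_image_le h)).op ≫
    (L.restrictAppIso (Δ.chart τ) ⊤).inv).hom

/-! ### Soft noncommutative toric schemes -/

/-- The edge-path monoid `M̆ = ⟨e₁*, e₁*⁻¹, …, eₙ*, eₙ*⁻¹⟩` of the lattice `M` with the inverse-closed
generating set `{±eᵢ*}`: homotopy classes of edge-paths at the identity vertex of the
Cayley graph are the reduced words in these letters, so this is the free group on `n` letters. -/
abbrev EdgePathMonoid (n : ℕ) : Type := FreeGroup (Fin n)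

/-- The built-in epimorphism `π : M̆ → M` (end point of an edge-path). -/
def edgeProj (n : ℕ) : EdgePathMonoid n →* CharLattice n :=
  FreeGroup.lift fun i => Multiplicative.ofAdd (Pi.single i 1)

/-- A submonoid of `M̆` is admissible to the cone `σ` if it is finitely generated, is mapped by `π`
onto `M_σ`, and an element of it whose image is invertible in `M_σ` is invertible in it. -/
structure IsAdmissible (σ : PointedCone ℝ (Fin n → ℝ)) (P : Submonoid (EdgePathMonoid n)) :
    Prop where
  fg : P.FG
  map_eq : P.map (edgeProj n) = dualMonoid σ
  inv_mem : ∀ m ∈ P, (edgeProj n m)⁻¹ ∈ dualMonoid σ → m⁻¹ ∈ P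

/-- A soft noncommutative toric scheme `Y̆(Δ)` with smooth fundamental charts: an inverse
`Δ`-system of admissible submonoids `M̆_σ` of `M̆`, with `M̆_σ` a free monoid on `n` letters for
every maximal cone `σ`, and `M̆_0 = M̆`. -/
structure SoftScheme (Δ : SmoothFan n) where
  monoid : Δ.Cone → Submonoid (EdgePathMonoid n)
  anti : ∀ {τ σ : Δ.Cone}, τ ≤ σ → monoid σ ≤ monoid τ
  admissible : ∀ σ : Δ.Cone, IsAdmissible σ.1 (monoid σ)
  free_of_isMax : ∀ σ : Δ.Cone, IsMax σ → Nonempty (monoid σ ≃* FreeMonoid (Fin n))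
  zero_eq_top : ∀ σ : Δ.Cone, σ.1 = ⊥ → monoid σ = ⊤

namespace SoftScheme

variable {Δ : SmoothFan n}

/-- `Y'` is a softening of `Y`: both have the same monoids on the maximal cones, and the
monoids of `Y'` on the other cones contain those of `Y`. -/
def IsSoftening (Y' Y : SoftScheme Δ) : Prop :=
  (∀ σ, IsMax σ → Y'.monoid σ = Y.monoid σ) ∧ ∀ σ, ¬ IsMax σ → Y.monoid σ ≤ Y'.monoid σ

/-- The function ring `R̆_σ = ℂ⟨M̆_σ⟩` of the chart `Ŭ_σ`. -/
abbrev ring (Y : SoftScheme Δ) (σ : Δ.Cone) : Type := MonoidAlgebra ℂ (Y.monoid σ)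

/-- The inclusion `R̆_σ → R̆_τ` for `τ ≤ σ`. -/
def res (Y : SoftScheme Δ) {τ σ : Δ.Cone} (h : τ ≤ σ) : Y.ring σ →+* Y.ring τ :=
  MonoidAlgebra.mapDomainRingHom ℂ (Submonoid.inclusion (Y.anti h))

/-- The monoid epimorphism `M̆_σ → M_σ` induced by `π`. -/
def monoidProj (Y : SoftScheme Δ) (σ : Δ.Cone) : Y.monoid σ →* dualMonoid σ.1 :=
  ((edgeProj n).comp (Y.monoid σ).subtype).codRestrict (dualMonoid σ.1) fun m => by
    rw [← (Y.admissible σ).map_eq]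
    exact ⟨m.1, m.2, rfl⟩

/-- The epimorphism `ℂ⟨M̆_σ⟩ → ℂ[M_σ]`; these define the embedding `Y(Δ) ⊂ Y̆(Δ)`. -/
def ringProj (Y : SoftScheme Δ) (σ : Δ.Cone) : Y.ring σ →+* coordRing σ.1 :=
  MonoidAlgebra.mapDomainRingHom ℂ (Y.monoidProj σ)

end SoftScheme

/-! ### Base change along a homomorphism of noncommutative rings -/

section BaseChange

variable {A B : Type} [Ring A] [Ring B] (φ : A →+* B) (F : Type) [AddCommGroup F] [Module A F]

/-- The left `B`-module `B ⊗_A F` for a homomorphism `φ : A → B` of (noncommutative) rings and a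
left `A`-module `F`: the quotient of `B ⊗_ℤ F` by the relations `b φ(a) ⊗ x = b ⊗ a x`. -/
abbrev BaseChange : Type :=
  (B ⊗[ℤ] F) ⧸ Submodule.span B
    (Set.range fun p : A × F => φ p.1 ⊗ₜ[ℤ] p.2 - (1 : B) ⊗ₜ[ℤ] (p.1 • p.2))

variable {F}

/-- The element `b ⊗ x` of `B ⊗_A F`. -/
def BaseChange.tmul (b : B) (x : F) : BaseChange φ F := Submodule.Quotient.mk (b ⊗ₜ[ℤ] x)

end BaseChange

/-! ### Modules on a soft noncommutative toric scheme -/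

/-- A left `𝒪_{Y̆(Δ)}`-module: left `R̆_σ`-modules `F̆_σ` and homomorphisms
`h_{στ} : R̆_τ ⊗_{R̆_σ} F̆_σ → F̆_τ` of left `R̆_τ`-modules for `τ` a proper face of `σ`,
with `h_{τρ} ∘ (R̆_ρ ⊗ h_{στ}) = h_{σρ}`; the latter is an identity of `R̆_ρ`-linear maps on
`R̆_ρ ⊗_{R̆_σ} F̆_σ`, stated on the generators `1 ⊗ s`. -/
structure LeftModule {Δ : SmoothFan n} (Y : SoftScheme Δ) where
  sec : Δ.Cone → Type
  [addCommGroup : ∀ σ, AddCommGroup (sec σ)]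
  [module : ∀ σ, Module (Y.ring σ) (sec σ)]
  glue : ∀ {τ σ : Δ.Cone} (h : τ < σ), BaseChange (Y.res h.le) (sec σ) →ₗ[Y.ring τ] sec τ
  glue_comp : ∀ {ρ τ σ : Δ.Cone} (h : ρ < τ) (h' : τ < σ) (s : sec σ),
    glue h (.tmul (Y.res h.le) 1 (glue h' (.tmul (Y.res h'.le) 1 s))) =
      glue (h.trans h') (.tmul (Y.res (h.trans h').le) 1 s)

namespace LeftModule

attribute [instance] LeftModule.addCommGroup LeftModule.module

variable {Δ : SmoothFan n} {Y : SoftScheme Δ}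

/-- Invertible left `𝒪_{Y̆(Δ)}`-modules: `F̆_σ ≃ R̆_σ` as a left `R̆_σ`-module for every `σ`, and
all `h_{στ}` are isomorphisms. -/
def IsInvertible (E : LeftModule Y) : Prop :=
  (∀ σ, Nonempty (E.sec σ ≃ₗ[Y.ring σ] Y.ring σ)) ∧
    ∀ {τ σ : Δ.Cone} (h : τ < σ), Function.Bijective (E.glue h)

/-- The left `𝒪_{Y̆(Δ)}`-module `E` extends the `𝒪_{Y(Δ)}`-module `L`: the restriction of `E` to
`Y(Δ) ⊂ Y̆(Δ)`, with modules `ℂ[M_σ] ⊗_{R̆_σ} F̆_σ` on the charts `U_σ` and the gluing induced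
by `h_{στ}`, is isomorphic to `L`. -/
def Extends (E : LeftModule Y) (L : Δ.toricVariety.Modules) : Prop :=
  ∃ θ : ∀ σ : Δ.Cone, BaseChange (Y.ringProj σ) (E.sec σ) ≃ₗ[coordRing σ.1] chartSections L σ,
    ∀ {τ σ : Δ.Cone} (h : τ < σ) (s : E.sec σ),
      θ τ (.tmul (Y.ringProj τ) 1 (E.glue h (.tmul (Y.res h.le) 1 s))) =
        chartRestrict L h.le (θ σ (.tmul (Y.ringProj σ) 1 s))

end LeftModule

end SoftToric

end

/-! An invertible sheaf on a smooth toric variety is given by characters, and characters lift to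
words in the free group. The coordinate ring of a maximal chart is a polynomial ring, so `L` is free
of rank one there and, by restriction, on every chart (`exists_generators`). Over the torus `U_0`
two generators differ by a unit of a Laurent polynomial ring, which is a constant times a character.
After rescaling, the generator on `U_σ` is a character `m_σ` times a fixed generator on the torus,
and for a face `τ` of `σ` the quotient `m_σ / m_τ` is invertible in `M_τ`
(`IsInvertibleSheaf.nonempty_cartierData`).

Lift each `m_σ` to a word `w_σ`. Free modules of rank one can be glued by right multiplication by
`w_σ w_τ⁻¹`; the cocycle identity telescopes, and abelianizing the words gives back `L`. The one
obstruction is that `w_σ w_τ⁻¹` must be a unit of the monoid at `τ`. The softening `soften` adjoins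
to that monoid all `w_σ w_ρ⁻¹` with `σ`, `ρ` containing `τ`. Their images are already invertible in
`M_τ`, so admissibility survives; over a maximal cone the only such quotient is `1`, so the
fundamental charts do not change.

For the second statement some soft scheme has to exist. Over each maximal cone, lift the basis of
`M` dual to its generators to words, and let these words, with the inverses that are forced,
generate the monoids of the faces. The point to prove is that the lifts generate a free monoid. In a
Magnus representation on noncommutative power series the lift `y_i` acts as `1 + X_i +` higher
terms, so products of the operators `y_i - 1` have distinct words as leading terms and are linearly
independent (`Magnus.freeMonoid_lift_injective`). -/

/-! ### Quasi-coherence of invertible sheaves -/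

theorem AlgebraicGeometry.Scheme.isQuasicoherent_unit (X : Scheme.{0}) :
    (SheafOfModules.unit X.ringCatSheaf).IsQuasicoherent :=
  (SheafOfModules.isQuasicoherent _).prop_of_iso
    (coproductUniqueIso fun _ : PUnit => SheafOfModules.unit X.ringCatSheaf)
    (inferInstanceAs (SheafOfModules.free PUnit : SheafOfModules X.ringCatSheaf).IsQuasicoherent)

/-- Quasi-coherence is local and the structure sheaf has it. The trivializations live on open
subschemes and are moved to the slice sites through `overEquiv`. -/
theorem SoftToric.IsInvertibleSheaf.isQuasicoherent {X : Scheme.{0}} {L : X.Modules}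
    (hL : SoftToric.IsInvertibleSheaf L) : L.IsQuasicoherent := by
  choose U hU e using hL
  have hX := X.isQuasicoherent_unit
  have (x : X) : SheafOfModules.IsQuasicoherent (SheafOfModules.over L (U x)) := by
    have h : SheafOfModules.IsQuasicoherent
      (SheafOfModules.over (SheafOfModules.unit X.ringCatSheaf) (U x)) :=
      SheafOfModules.isQuasicoherent_over _ _
    let i : SheafOfModules.over L (U x) ≅
        SheafOfModules.over (SheafOfModules.unit X.ringCatSheaf) (U x) :=
      (Scheme.Modules.overEquiv (U x)).functor.preimageIso
        ((Scheme.Modules.overFunctorEquiv (U x)).app L ≪≫ (e x).some ≪≫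
          (Scheme.Modules.restrictUnitIso (U x).ι).symm ≪≫
          ((Scheme.Modules.overFunctorEquiv (U x)).app (SheafOfModules.unit X.ringCatSheaf)).symm)
    exact (SheafOfModules.isQuasicoherent _).prop_of_iso i.symm h
  apply SheafOfModules.IsQuasicoherent.of_coversTop L U
  rw [Opens.coversTop_iff]
  exact top_le_iff.1 fun x _ => TopologicalSpace.Opens.mem_iSup.2 ⟨x, hU x⟩

/-! ### Modules that are locally free of rank one -/

/-- A module over a domain that is, up to denominators `r ∈ s`, freely generated by one element
`e r`, is invertible as soon as `s` generates the unit ideal. -/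
theorem Module.Invertible.of_span_eq_top {R N : Type*} [CommRing R] [IsDomain R] [AddCommGroup N]
    [Module R N] (s : Finset R) (hs : Ideal.span (s : Set R) = ⊤) (e : R → N)
    (hgen : ∀ r ∈ s, ∀ x : N, ∃ (k : ℕ) (a : R), r ^ k • x = a • e r)
    (hfree : ∀ r ∈ s, ∀ a : R, a • e r = 0 → a = 0) : Module.Invertible R N := by
  classical
  -- A partition of unity with prescribed exponents: a maximal ideal containing the powers would
  -- contain `s`.
  have hpow (K : R → ℕ) : ∃ c : R → R, ∑ r ∈ s, c r * r ^ K r = 1 := by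
    have h1 : Ideal.span ((fun r => r ^ K r) '' (s : Set R)) = ⊤ := by
      by_contra hne
      obtain ⟨m, hm, hle⟩ := Ideal.exists_le_maximal _ hne
      refine hm.ne_top (top_le_iff.1 (hs ▸ Ideal.span_le.2 fun r hr => ?_))
      exact hm.isPrime.mem_of_pow_mem _ (hle (Ideal.subset_span ⟨r, hr, rfl⟩))
    have h2 := (Ideal.eq_top_iff_one _).1 h1
    rw [Ideal.span, Submodule.mem_span_image_finset_iff_exists_fun] at h2
    obtain ⟨c, hc⟩ := h2
    refine ⟨fun r => if h : r ∈ s then c ⟨r, h⟩ else 0, ?_⟩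
    rw [← hc, ← Finset.sum_coe_sort]
    simp
  have hsep (x : N) (hx : ∀ r ∈ s, ∃ k : ℕ, r ^ k • x = 0) : x = 0 := by
    choose! K hK using hx
    obtain ⟨c, hc⟩ := hpow K
    rw [← one_smul R x, ← hc, Finset.sum_smul]
    exact Finset.sum_eq_zero fun r hr => by rw [mul_smul, hK r hr, smul_zero]
  have hfin : Submodule.span R (e '' (s : Set R)) = ⊤ := by
    refine top_le_iff.1 fun x _ => ?_
    choose! K a ha using fun r hr => hgen r hr x
    obtain ⟨c, hc⟩ := hpow K
    rw [← one_smul R x, ← hc, Finset.sum_smul]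
    refine Submodule.sum_mem _ fun r hr => ?_
    rw [mul_smul, ha r hr]
    exact Submodule.smul_mem _ _ (Submodule.smul_mem _ _ (Submodule.subset_span ⟨r, hr, rfl⟩))
  -- The finitely many `e q` generate `N`, so an exponent that serves all of them serves every
  -- element.
  have hunif (r : R) (hr : r ∈ s) : ∃ k : ℕ, ∀ x : N, ∃ a : R, r ^ k • x = a • e r := by
    choose K a ha using fun q : R => hgen r hr (e q)
    refine ⟨∑ q ∈ s, K q, fun x => ?_⟩
    have hx : x ∈ Submodule.span R (e '' (s : Set R)) := hfin ▸ Submodule.mem_top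
    induction hx using Submodule.span_induction with
    | mem x hx =>
      obtain ⟨q, hq, rfl⟩ := hx
      obtain ⟨d, hd⟩ := Nat.exists_eq_add_of_le
        (Finset.single_le_sum (f := K) (fun _ _ => Nat.zero_le _) hq)
      refine ⟨r ^ d * a q, ?_⟩
      rw [hd, add_comm, pow_add, mul_smul, ha, mul_smul]
    | zero => exact ⟨0, by simp⟩
    | add x y _ _ hx hy =>
      obtain ⟨b, hb⟩ := hx
      obtain ⟨c, hc⟩ := hy
      exact ⟨b + c, by rw [smul_add, hb, hc, add_smul]⟩
    | smul t x _ hx =>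
      obtain ⟨b, hb⟩ := hx
      exact ⟨t * b, by rw [smul_comm, hb, mul_smul]⟩
  -- The functional is the coefficient of `r ^ k • x` along `e r`; freeness makes it well defined
  -- and linear.
  have hfunc (r : R) (hr : r ∈ s) : ∃ (k : ℕ) (ψ : Module.Dual R N), ψ (e r) = r ^ k := by
    obtain ⟨k, hk⟩ := hunif r hr
    choose ψ hψ using hk
    have huniq (a b : R) (hab : a • e r = b • e r) : a = b :=
      sub_eq_zero.1 (hfree r hr _ (by rw [sub_smul, hab, sub_self]))
    refine ⟨k, ⟨⟨ψ, fun x y => huniq _ _ ?_⟩, fun t x => huniq _ _ ?_⟩, huniq _ _ (hψ _).symm⟩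
    · rw [← hψ, smul_add, hψ, hψ, add_smul]
    · rw [← hψ, smul_comm, hψ]; simp [mul_smul]
  -- Rank one: up to powers of `r`, both `x` and `y` are multiples of `e r`.
  have hcomm (φ : Module.Dual R N) (x y : N) : φ x • y = φ y • x := by
    refine sub_eq_zero.1 (hsep _ fun r hr => ?_)
    obtain ⟨k, hk⟩ := hunif r hr
    obtain ⟨a, ha⟩ := hk x
    obtain ⟨b, hb⟩ := hk y
    refine ⟨k + k, ?_⟩
    have h1 : r ^ (k + k) • φ x • y = φ (r ^ k • x) • r ^ k • y := by
      rw [map_smul, smul_eq_mul, pow_add, smul_smul, smul_smul]; congr 1; ring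
    have h2 : r ^ (k + k) • φ y • x = φ (r ^ k • y) • r ^ k • x := by
      rw [map_smul, smul_eq_mul, pow_add, smul_smul, smul_smul]; congr 1; ring
    rw [smul_sub, h1, h2, ha, hb, map_smul, map_smul, smul_eq_mul, smul_eq_mul, smul_smul,
      smul_smul, sub_eq_zero]
    congr 1; ring
  choose! K ψ hψ using hfunc
  obtain ⟨c, hc⟩ := hpow K
  have hone : ∑ r ∈ s, c r * ψ r (e r) = 1 := by
    rw [← hc]; exact Finset.sum_congr rfl fun r hr => by rw [hψ r hr]
  refine ⟨(injective_iff_map_eq_zero _).2 fun t ht => ?_, fun a => ?_⟩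
  -- Up to the factor `ψ r (e r)`, a tensor is recovered from its contraction. These factors have a
  -- combination equal to `1`, so the contraction is injective.
  · have key (t : Module.Dual R N ⊗[R] N) (r : R) : ψ r (e r) • t =
        (LinearMap.toSpanSingleton R (Module.Dual R N) (ψ r) (contractLeft R N t)) ⊗ₜ e r := by
      induction t with
      | zero => simp
      | add x y hx hy => rw [smul_add, hx, hy, map_add, map_add, TensorProduct.add_tmul]
      | tmul φ x =>
        have h1 : ψ r x • φ = φ x • ψ r := by
          ext y
          have := congrArg φ (hcomm (ψ r) x y)
          simpa [mul_comm] using this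
        rw [contractLeft_apply, LinearMap.toSpanSingleton_apply, ← h1,
          TensorProduct.smul_tmul, ← hcomm, ← TensorProduct.tmul_smul]
    rw [← one_smul R t, ← hone, Finset.sum_smul]
    refine Finset.sum_eq_zero fun r _ => ?_
    rw [mul_smul, key, ht, map_zero, TensorProduct.zero_tmul, smul_zero]
  · refine ⟨∑ r ∈ s, (a * c r) • (ψ r ⊗ₜ[R] e r), ?_⟩
    simp only [map_sum, map_smul, contractLeft_apply, smul_eq_mul, mul_assoc, ← Finset.mul_sum]
    rw [hone, mul_one]


/-- The Picard group of a GCD domain is trivial, so the invertible module is free. -/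
theorem Module.exists_bijective_smul_of_span_eq_top {R N : Type*} [CommRing R] [IsDomain R]
    [IsGCDMonoid R] [AddCommGroup N] [Module R N] (s : Finset R)
    (hs : Ideal.span (s : Set R) = ⊤) (e : R → N)
    (hgen : ∀ r ∈ s, ∀ x : N, ∃ (k : ℕ) (a : R), r ^ k • x = a • e r)
    (hfree : ∀ r ∈ s, ∀ a : R, a • e r = 0 → a = 0) :
    ∃ g : N, Function.Bijective fun a : R => a • g := by
  have := Module.Invertible.of_span_eq_top s hs e hgen hfree
  obtain ⟨i⟩ := Module.Invertible.free_iff_linearEquiv.1 (inferInstance : Module.Free R N)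
  refine ⟨i.symm 1, ?_⟩
  convert i.symm.bijective using 2 with a
  rw [← map_smul, smul_eq_mul, mul_one]

/-! ### Sections of locally trivial modules on affine schemes -/

namespace AlgebraicGeometry.Scheme.Modules

/-- Freeness of rank one is expressed throughout by a section `g` with `a ↦ a • g` bijective. This
form passes along isomorphisms that also change the ring of sections, as restriction to an open
subscheme does. -/
theorem exists_bijective_smul_of_iso {X : Scheme.{0}} {M N : X.Modules} (i : M ≅ N) {V : X.Opens}
    (h : ∃ g : Γ(N, V), Function.Bijective fun a : Γ(X, V) => a • g) :
    ∃ g : Γ(M, V), Function.Bijective fun a : Γ(X, V) => a • g := by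
  obtain ⟨g, hg⟩ := h
  refine ⟨i.inv.app V g, ?_⟩
  have h1 : Function.Bijective (i.inv.app V) := ConcreteCategory.bijective_of_isIso _
  convert h1.comp hg using 2 with a
  exact (i.inv.app_smul a g).symm

/-- The structure sheaf, as an `𝒪_X`-module. -/
noncomputable def structureModule (X : Scheme.{0}) : X.Modules := SheafOfModules.unit X.ringCatSheaf

theorem exists_bijective_smul_structureModule (X : Scheme.{0}) (V : X.Opens) :
    ∃ g : Γ(structureModule X, V),
      Function.Bijective fun a : Γ(X, V) => a • g := by
  refine ⟨(1 : Γ(X, V)), ?_⟩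
  have h : (fun a : Γ(X, V) => a * 1) = id := funext mul_one
  exact (congrArg Function.Bijective h).mpr Function.bijective_id

theorem exists_bijective_smul_of_restrict {X U : Scheme.{0}} (L : X.Modules) (f : U ⟶ X)
    [IsOpenImmersion f] {V : U.Opens} 
    (h : ∃ g : Γ(L.restrict f, V), Function.Bijective fun a : Γ(U, V) => a • g) :
    ∃ g : Γ(L, f ''ᵁ V), Function.Bijective fun a : Γ(X, f ''ᵁ V) => a • g := by
  obtain ⟨g, hg⟩ := h
  refine ⟨(L.restrictAppIso f V).hom g, ?_⟩
  have h2 : Function.Bijective (f.appIso V).hom := ConcreteCategory.bijective_of_isIso _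
  have h3 : Function.Bijective (L.restrictAppIso f V).hom := ConcreteCategory.bijective_of_isIso _
  convert h3.comp (hg.comp h2) using 2 with a
  simp

theorem exists_bijective_smul_of_restrict_iso {X U : Scheme.{0}} (L : X.Modules) (f : U ⟶ X)
    [IsOpenImmersion f] (i : L.restrict f ≅ (SheafOfModules.unit U.ringCatSheaf : U.Modules))
    {W : X.Opens} (hW : W ≤ f.opensRange) :
    ∃ g : Γ(L, W), Function.Bijective fun a : Γ(X, W) => a • g := by
  obtain ⟨V, rfl⟩ : ∃ V : U.Opens, W = f ''ᵁ V :=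
    ⟨f ⁻¹ᵁ W, by rw [f.image_preimage_eq_opensRange_inf, inf_eq_right.2 hW]⟩
  exact exists_bijective_smul_of_restrict L f
    (exists_bijective_smul_of_iso (N := structureModule U) i
      (exists_bijective_smul_structureModule U V))

section Spec

variable {R : CommRingCat.{0}} (M : (Spec R).Modules) [M.IsQuasicoherent]

theorem isLocalizing_of_isQuasicoherent : IsLocalizing (modulesSpecToSheaf.obj M) :=
  (isIso_fromTildeΓ_iff_isLocalizing M).1 inferInstance

/-- The open set is a variable with an equation so that the result also applies to the image of an
open immersion that is merely equal to a basic open set. -/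
theorem exists_pow_smul_eq_zero_of_map_eq_zero {r : R} {V : (Spec R).Opens}
    (hV : V = PrimeSpectrum.basicOpen r) (x : Γ(M, ⊤))
    (hx : M.presheaf.map (homOfLE (le_top : V ≤ ⊤)).op x = 0) : ∃ k : ℕ, r ^ k • x = 0 := by
  subst hV
  have h := isLocalizing_of_isQuasicoherent M r
  obtain ⟨⟨_, k, rfl⟩, hc⟩ := h.exists_of_eq (x₁ := x) (x₂ := (0 : Γ(M, ⊤)))
    (hx.trans (map_zero (M.presheaf.map _).hom).symm)
  exact ⟨k, hc.trans (smul_zero (r ^ k))⟩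

theorem exists_map_eq_pow_smul {r : R} {V : (Spec R).Opens}
    (hV : V = PrimeSpectrum.basicOpen r) (t : Γ(M, V)) :
    ∃ (k : ℕ) (x : Γ(M, ⊤)), M.presheaf.map (homOfLE (le_top : V ≤ ⊤)).op x = r ^ k • t := by
  subst hV
  have h := isLocalizing_of_isQuasicoherent M r
  obtain ⟨⟨x, ⟨_, k, rfl⟩⟩, hx⟩ := h.surj t
  exact ⟨k, x, hx.symm⟩

/-- By quasi-coherence a generator over a basic open set `D(r)` becomes, after multiplication by a
power of `r`, the restriction of a global section. Finitely many such `r` generate the unit ideal,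
and the algebraic criterion applies. -/
theorem exists_bijective_smul_of_locally [IsDomain R] [IsGCDMonoid R]
    (h : ∀ x : Spec R, ∃ U : (Spec R).Opens, x ∈ U ∧ ∀ W ≤ U,
      ∃ g : Γ(M, W), Function.Bijective fun a : Γ(Spec R, W) => a • g) :
    ∃ g : Γ(M, ⊤), Function.Bijective fun a : R => a • g := by
  classical
  have h1 (x : PrimeSpectrum R) : ∃ r : R, r ∉ x.asIdeal ∧ ∃ e : Γ(M, ⊤),
      (∀ y : Γ(M, ⊤), ∃ (k : ℕ) (a : R), r ^ k • y = a • e) ∧ ∀ a : R, a • e = 0 → a = 0 := by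
    obtain ⟨U, hxU, hU⟩ := h x
    obtain ⟨_, ⟨_, ⟨r, rfl⟩, rfl⟩, hxr, hrU⟩ :=
      PrimeSpectrum.isBasis_basic_opens.exists_subset_of_mem_open hxU U.2
    have hr0 : r ≠ 0 := by
      rintro rfl
      exact hxr x.asIdeal.zero_mem
    obtain ⟨V, hV⟩ : ∃ V : (Spec R).Opens, V = PrimeSpectrum.basicOpen r := ⟨_, rfl⟩
    have hloc : IsLocalization.Away r Γ(Spec R, V) := by subst hV; infer_instance
    obtain ⟨g, hg⟩ := hU V (hV ▸ hrU)
    obtain ⟨k, e, he⟩ := exists_map_eq_pow_smul M hV g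
    refine ⟨r, hxr, e, fun y => ?_, fun a ha => ?_⟩
    · obtain ⟨b, hb⟩ := hg.2 (M.presheaf.map (homOfLE (le_top : V ≤ ⊤)).op y)
      obtain ⟨⟨c, ⟨_, l, rfl⟩⟩, hc⟩ := IsLocalization.surj (Submonoid.powers r) b
      dsimp only at hc hb
      -- On `D(r)` one has `y = (c / r ^ l) g` and `e = r ^ k g`.
      have h2 : M.presheaf.map (homOfLE (le_top : V ≤ ⊤)).op (r ^ (k + l) • y - c • e) = 0 := by
        rw [map_sub, map_smul_Spec, map_smul_Spec, he, ← hb, pow_add, mul_smul, sub_eq_zero,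
          smul_comm c, ← algebraMap_smul Γ(Spec R, V) (r ^ l), ← algebraMap_smul Γ(Spec R, V) c,
          ← mul_smul, mul_comm, hc]
      obtain ⟨j, hj⟩ := exists_pow_smul_eq_zero_of_map_eq_zero M hV _ h2
      refine ⟨j + (k + l), r ^ j * c, ?_⟩
      rw [pow_add, mul_smul, mul_smul, ← sub_eq_zero, ← smul_sub, hj]
    · have h2 : algebraMap R Γ(Spec R, V) (a * r ^ k) • g = 0 := by
        rw [algebraMap_smul, mul_smul, ← he, ← map_smul_Spec, ha, map_zero]
      have h3 : algebraMap R Γ(Spec R, V) (a * r ^ k) = 0 := hg.1 (h2.trans (zero_smul _ g).symm)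
      have h4 := (IsLocalization.injective Γ(Spec R, V)
        (powers_le_nonZeroDivisors_of_noZeroDivisors hr0)) (h3.trans (map_zero _).symm)
      exact (mul_eq_zero.1 h4).resolve_right (pow_ne_zero k hr0)
  choose r hr e he using h1
  have hspan : Ideal.span (Set.range r) = ⊤ := by
    by_contra hne
    obtain ⟨m, hm, hle⟩ := Ideal.exists_le_maximal _ hne
    exact hr ⟨m, hm.isPrime⟩ (hle (Ideal.subset_span ⟨_, rfl⟩))
  obtain ⟨s, hs, hs'⟩ := (Ideal.span_eq_top_iff_finite _).1 hspan
  have h2 (q : R) (hq : q ∈ s) : ∃ x, r x = q := hs hq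
  choose! p hp using h2
  refine Module.exists_bijective_smul_of_span_eq_top s hs' (fun q => e (p q)) ?_ ?_
  · intro q hq
    have := (he (p q)).1
    rwa [hp q hq] at this
  · exact fun q _ => (he (p q)).2

end Spec

end AlgebraicGeometry.Scheme.Modules

/-! ### Restriction from an affine chart to a smaller one -/

namespace AlgebraicGeometry.Scheme.Modules

theorem app_smul_Spec {R : CommRingCat.{0}} {M N : (Spec R).Modules} (φ : M ⟶ N)
    {U : (Spec R).Opens} (r : R) (x : Γ(M, U)) : φ.app U (r • x) = r • φ.app U x := by
  rw [smul_Spec_def, smul_Spec_def, Hom.app_smul]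

theorem exists_bijective_smul_restrict {X U : Scheme.{0}} (L : X.Modules) (f : U ⟶ X)
    [IsOpenImmersion f] {V : U.Opens}
    (h : ∃ g : Γ(L, f ''ᵁ V), Function.Bijective fun a : Γ(X, f ''ᵁ V) => a • g) :
    ∃ g : Γ(L.restrict f, V), Function.Bijective fun a : Γ(U, V) => a • g := by
  obtain ⟨g, hg⟩ := h
  refine ⟨(L.restrictAppIso f V).inv g, ?_⟩
  have h2 : Function.Bijective (f.appIso V).inv := ConcreteCategory.bijective_of_isIso _
  have h3 : Function.Bijective (L.restrictAppIso f V).inv := ConcreteCategory.bijective_of_isIso _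
  convert h3.comp (hg.comp h2) using 2 with a
  simp

/-- The composite is a separate variable `p` because the smaller toric chart equals such a composite
only propositionally. -/
theorem restrictFunctorComp_hom_app_top {X Y Z : Scheme.{0}} (f : X ⟶ Y) (g : Y ⟶ Z) (p : X ⟶ Z)
    [IsOpenImmersion f] [IsOpenImmersion g] [IsOpenImmersion p] (w : f ≫ g = p) (L : Z.Modules)
    (h : p ''ᵁ ⊤ ≤ g ''ᵁ ⊤) :
    ∃ j : L.restrict p ≅ (L.restrict g).restrict f, ∀ x : Γ(L.restrict g, ⊤),
      ((L.restrict g).restrictAppIso f ⊤).inv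
        ((L.restrict g).presheaf.map (homOfLE (le_top : f ''ᵁ ⊤ ≤ ⊤)).op x) =
      j.hom.app ⊤ ((L.restrictAppIso p ⊤).inv
        (L.presheaf.map (homOfLE h).op ((L.restrictAppIso g ⊤).hom x))) := by
  subst w
  refine ⟨(restrictFunctorComp f g).app L, fun x => ?_⟩
  exact ConcreteCategory.congr_hom
    (L.presheaf.map_comp (homOfLE h).op (eqToHom (Scheme.Hom.comp_image f g ⊤).symm).op) x

section

variable {R S : CommRingCat.{0}} (φ : R ⟶ S) [IsOpenImmersion (Spec.map φ)] {X : Scheme.{0}}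
  (g : Spec R ⟶ X) (p : Spec S ⟶ X) [IsOpenImmersion g] [IsOpenImmersion p]
  (w : Spec.map φ ≫ g = p) (L : X.Modules)

/-- The restriction of sections of a module from an affine open chart to a smaller one. -/
noncomputable def restrictSections (h : p ''ᵁ ⊤ ≤ g ''ᵁ ⊤) :
    Γ(L.restrict g, ⊤) →+ Γ(L.restrict p, ⊤) :=
  ((L.restrictAppIso g ⊤).hom ≫ L.presheaf.map (homOfLE h).op ≫ (L.restrictAppIso p ⊤).inv).hom

-- This moves questions about the smaller chart to an open subset of `Spec R`, where sections are
-- localizations of global sections.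
include w in
theorem exists_equiv_restrictSections (h : p ''ᵁ ⊤ ≤ g ''ᵁ ⊤) :
    ∃ e : Γ(L.restrict p, ⊤) ≃+ Γ(L.restrict g, Spec.map φ ''ᵁ ⊤),
      (∀ (r : R) (y : Γ(L.restrict p, ⊤)), e (φ r • y) = r • e y) ∧
      ∀ x : Γ(L.restrict g, ⊤), e (restrictSections g p L h x) =
        (L.restrict g).presheaf.map (homOfLE (le_top : Spec.map φ ''ᵁ ⊤ ≤ ⊤)).op x := by
  obtain ⟨j, hj⟩ := restrictFunctorComp_hom_app_top (Spec.map φ) g p w L h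
  have h1 : Function.Bijective (j.hom.app ⊤) := ConcreteCategory.bijective_of_isIso _
  let i := (L.restrict g).restrictAppIso (Spec.map φ) ⊤
  have h2 : Function.Bijective i.hom := ConcreteCategory.bijective_of_isIso _
  refine ⟨AddEquiv.ofBijective (AddMonoidHom.comp i.hom.hom (j.hom.app ⊤).hom) (h2.comp h1),
    fun r y => ?_, fun x => ?_⟩
  · change i.hom (j.hom.app ⊤ (φ r • y)) = r • i.hom (j.hom.app ⊤ y)
    rw [app_smul_Spec]
    exact restrictAppIso_smul_Spec φ r (j.hom.app ⊤ y)
  · change i.hom (j.hom.app ⊤ _) = _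
    refine (congrArg i.hom (hj x).symm).trans ?_
    rfl

include w in
theorem restrictSections_smul (h : p ''ᵁ ⊤ ≤ g ''ᵁ ⊤) (r : R) (x : Γ(L.restrict g, ⊤)) :
    restrictSections g p L h (r • x) = φ r • restrictSections g p L h x := by
  obtain ⟨e, he, he'⟩ := exists_equiv_restrictSections φ g p w L h
  apply e.injective
  rw [he, he', he', map_smul_Spec]

-- Both `S` and the sections over the smaller chart are localizations at `u`, so bijectivity of `a ↦
-- a • s` localizes as well.
include w in
theorem bijective_smul_restrictSections (h : p ''ᵁ ⊤ ≤ g ''ᵁ ⊤) [(L.restrict g).IsQuasicoherent]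
    (u : R) (hu : Spec.map φ ''ᵁ ⊤ = PrimeSpectrum.basicOpen u)
    (hφ : letI := φ.hom.toAlgebra; IsLocalization.Away u S)
    (s : Γ(L.restrict g, ⊤)) (hs : Function.Bijective fun a : R => a • s) :
    Function.Bijective fun a : S => a • restrictSections g p L h s := by
  obtain ⟨e, he, he'⟩ := exists_equiv_restrictSections φ g p w L h
  let := φ.hom.toAlgebra
  have hφ' : IsUnit (φ u) := IsLocalization.Away.algebraMap_isUnit (S := S) u
  have hfrac (a : S) : ∃ (k : ℕ) (b : R), φ u ^ k * a = φ b := by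
    obtain ⟨⟨b, ⟨_, k, rfl⟩⟩, hb⟩ := IsLocalization.surj (Submonoid.powers u) a
    refine ⟨k, b, Eq.trans ?_ hb⟩
    rw [mul_comm]
    exact congrArg (a * ·) (map_pow φ.hom u k).symm
  constructor
  · refine (injective_iff_map_eq_zero
      (AddMonoidHom.mk' (fun a : S => a • restrictSections g p L h s)
        fun a b => add_smul a b _)).2 fun a ha => ?_
    replace ha : a • restrictSections g p L h s = 0 := ha
    obtain ⟨k, b, hb⟩ := hfrac a
    have h1 : restrictSections g p L h (b • s) = 0 := by
      rw [restrictSections_smul φ g p w, ← hb, mul_smul, ha, smul_zero]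
    obtain ⟨l, hl⟩ := exists_pow_smul_eq_zero_of_map_eq_zero _ hu (b • s)
      (by rw [← he', h1, map_zero])
    have h2 : u ^ l * b = 0 := hs.1 (by simpa [mul_smul] using hl)
    have h3 : φ u ^ l * φ b = 0 := by rw [← map_pow, ← map_mul, h2, map_zero]
    rw [← hb, ← mul_assoc, ← pow_add] at h3
    exact ((hφ'.pow _).mul_right_eq_zero).1 h3
  · intro t
    obtain ⟨k, x, hx⟩ := exists_map_eq_pow_smul _ hu (e t)
    obtain ⟨a, rfl⟩ := hs.2 x
    have h1 : φ a • restrictSections g p L h s = φ u ^ k • t := by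
      apply e.injective
      rw [← map_pow, he, he, ← hx, he', map_smul_Spec]
    obtain ⟨v, hv⟩ := (hφ'.pow k).exists_left_inv
    refine ⟨v * φ a, ?_⟩
    dsimp only
    rw [mul_smul, h1, ← mul_smul, hv, one_smul]

end

end AlgebraicGeometry.Scheme.Modules

/-! ### Sections over the toric charts -/

namespace SoftToric

open AlgebraicGeometry.Scheme.Modules

variable {n : ℕ} {Δ : SmoothFan n} (L : Δ.toricVariety.Modules) {τ σ : Δ.Cone}

/-- The open immersion `U_τ ⟶ U_σ` for `τ ≤ σ`, as a morphism of spectra. -/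
noncomputable abbrev chartMap (h : τ ≤ σ) :
    Spec (CommRingCat.of (coordRing τ.1)) ⟶ Spec (CommRingCat.of (coordRing σ.1)) :=
  Spec.map (CommRingCat.ofHom (coordRes h))

instance (h : τ ≤ σ) : IsOpenImmersion (chartMap h) :=
  inferInstanceAs (IsOpenImmersion (Δ.charts.map (homOfLE h)))

theorem image_chartMap_top (h : τ ≤ σ) {u : Fin n → ℤ} (hu : CutsOut u τ.1 σ.1) :
    chartMap h ''ᵁ ⊤ = PrimeSpectrum.basicOpen
      (MonoidAlgebra.of ℂ (dualMonoid σ.1) ⟨Multiplicative.ofAdd u, hu.1⟩) := by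
  refine TopologicalSpace.Opens.ext (Eq.trans ?_ (Δ.range_charts_map (homOfLE h) hu))
  exact Set.image_univ

theorem chartRestrict_smul (h : τ ≤ σ) (r : coordRing σ.1) (x : chartSections L σ) :
    chartRestrict L h (r • x) = coordRes h r • chartRestrict L h x :=
  restrictSections_smul (CommRingCat.ofHom (coordRes h)) (Δ.chart σ) (Δ.chart τ)
    (Δ.map_chart (homOfLE h)) L (Δ.chart_image_le h) r x

theorem bijective_smul_chartRestrict (hL : IsInvertibleSheaf L) (h : τ ≤ σ)
    (s : chartSections L σ) (hs : Function.Bijective fun a : coordRing σ.1 => a • s) :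
    Function.Bijective fun a : coordRing τ.1 => a • chartRestrict L h s := by
  obtain ⟨u, hu⟩ := Δ.exists_cutsOut h
  obtain ⟨S, hS⟩ := Δ.rational _ σ.2
  have := hL.isQuasicoherent
  exact bijective_smul_restrictSections (CommRingCat.ofHom (coordRes h)) (Δ.chart σ) (Δ.chart τ)
    (Δ.map_chart (homOfLE h)) L (Δ.chart_image_le h) _ (image_chartMap_top h hu)
    (isLocalization_coordRing h hu hS) s hs

theorem exists_bijective_smul_chartSections (hL : IsInvertibleSheaf L) (σ : Δ.Cone)
    [IsDomain (coordRing σ.1)] [IsGCDMonoid (coordRing σ.1)] :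
    ∃ s : chartSections L σ, Function.Bijective fun a : coordRing σ.1 => a • s := by
  have := hL.isQuasicoherent
  refine exists_bijective_smul_of_locally (R := .of (coordRing σ.1))
    (L.restrict (Δ.chart σ)) fun x => ?_
  obtain ⟨U, hxU, ⟨i⟩⟩ := hL (Δ.chart σ x)
  refine ⟨Δ.chart σ ⁻¹ᵁ U, hxU, fun W hW => ?_⟩
  refine exists_bijective_smul_restrict L (Δ.chart σ) ?_
  refine exists_bijective_smul_of_restrict_iso L U.ι i ?_
  rw [Scheme.Opens.opensRange_ι]
  exact ((Δ.chart σ).image_mono hW).trans ((Δ.chart σ).image_preimage_le U)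

theorem chartRestrict_chartRestrict {ρ : Δ.Cone} (h : τ ≤ σ) (h' : ρ ≤ τ)
    (x : chartSections L σ) :
    chartRestrict L h' (chartRestrict L h x) = chartRestrict L (h'.trans h) x :=
  (ConcreteCategory.congr_hom (L.presheaf.map_comp (homOfLE (Δ.chart_image_le h)).op
    (homOfLE (Δ.chart_image_le h')).op) x).symm

end SoftToric

/-! ### Units of monoid algebras, and coordinate rings of smooth cones -/

/-- If the supports had more than one pair of elements, two different pairs would have a unique
product. Each would contribute a nonzero coefficient to `a * b = 1`, so both products would equal
`1`, against uniqueness. -/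
theorem MonoidAlgebra.exists_eq_single_of_mul_eq_one {K G : Type*} [Field K] [CommMonoid G]
    [TwoUniqueProds G] {a b : MonoidAlgebra K G} (h : a * b = 1) :
    ∃ (g : G) (c : K), c ≠ 0 ∧ a = MonoidAlgebra.single g c := by
  classical
  have ha : a ≠ 0 := by rintro rfl; simp at h
  have hb : b ≠ 0 := by rintro rfl; simp at h
  have hcard : a.coeff.support.card * b.coeff.support.card ≤ 1 := by
    by_contra! hc
    obtain ⟨p, hp, q, hq, hpq, hp', hq'⟩ := TwoUniqueProds.uniqueMul_of_one_lt_card hc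
    rw [Finset.mem_product] at hp hq
    have key (p : G × G) (hp : p.1 ∈ a.coeff.support ∧ p.2 ∈ b.coeff.support)
        (hu : UniqueMul a.coeff.support b.coeff.support p.1 p.2) : p.1 * p.2 = 1 := by
      by_contra hne
      have h1 := MonoidAlgebra.coeff_mul_mul_of_uniqueMul hu
      rw [h, MonoidAlgebra.one_def, MonoidAlgebra.coeff_single, Finsupp.single_eq_of_ne hne] at h1
      exact mul_ne_zero (Finsupp.mem_support_iff.1 hp.1) (Finsupp.mem_support_iff.1 hp.2) h1.symm
    exact hpq (Prod.ext_iff.2 (hq' hp.1 hp.2 ((key p hp hp').trans (key q hq hq').symm)))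
  have ha' : a.coeff.support.card = 1 := by
    have h1 : 0 < a.coeff.support.card := Finset.card_pos.2 (by simpa using ha)
    have h2 : 0 < b.coeff.support.card := Finset.card_pos.2 (by simpa using hb)
    nlinarith
  obtain ⟨g, c, hc, hg⟩ := Finsupp.card_support_eq_one'.1 ha'
  exact ⟨g, c, hc, MonoidAlgebra.ext (by simpa using hg)⟩

namespace SoftToric

variable {n : ℕ}

instance (S : Submonoid (CharLattice n)) : TwoUniqueProds S :=
  TwoUniqueProds.of_injective_mulHom (S.subtype : S →ₙ* CharLattice n) Subtype.val_injective
    inferInstance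

/-- The `i`-th vector of the basis of `M` dual to the basis `b` of `N`. -/
noncomputable def dualVec (b : Module.Basis (Fin n) ℤ (Fin n → ℤ)) (i : Fin n) : Fin n → ℤ :=
  fun k => b.coord i (Pi.single k 1)

variable (b : Module.Basis (Fin n) ℤ (Fin n → ℤ))

theorem dualVec_dotProduct (i : Fin n) (w : Fin n → ℤ) : dualVec b i ⬝ᵥ w = b.coord i w := by
  conv_rhs => rw [LinearMap.pi_apply_eq_sum_univ (b.coord i) w]
  exact Finset.sum_congr rfl fun k _ => by
    simp only [dualVec, smul_eq_mul]
    rw [mul_comm]; congr 2; ext j; simp [Pi.single_apply, eq_comm]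

theorem dualVec_dotProduct_basis (i j : Fin n) :
    dualVec b i ⬝ᵥ b j = if i = j then 1 else 0 := by
  rw [dualVec_dotProduct, Module.Basis.coord_apply, Module.Basis.repr_self,
    Finsupp.single_apply]
  simp [eq_comm]

theorem sum_dotProduct_smul_dualVec (m : Fin n → ℤ) : ∑ i, (m ⬝ᵥ b i) • dualVec b i = m := by
  refine dotProduct_eq _ _ fun w => ?_
  rw [sum_dotProduct]
  conv_rhs => rw [← b.sum_repr w]
  rw [dotProduct_sum]
  refine Finset.sum_congr rfl fun i _ => ?_
  rw [smul_dotProduct, dualVec_dotProduct, dotProduct_smul, Module.Basis.coord_apply, smul_eq_mul,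
    smul_eq_mul, mul_comm]

theorem sum_smul_dualVec_dotProduct (a : Fin n → ℤ) (j : Fin n) :
    (∑ i, a i • dualVec b i) ⬝ᵥ b j = a j := by
  simp only [sum_dotProduct, smul_dotProduct, dualVec_dotProduct_basis]
  simp

/-- The cone generated by a `ℤ`-basis of `N`. -/
noncomputable abbrev basisCone : PointedCone ℝ (Fin n → ℝ) :=
  PointedCone.hull ℝ (Set.range fun i => latticeVec (b i))

theorem pairing_latticeVec_eq_dotProduct (m v : Fin n → ℤ) :
    pairing m (latticeVec v) = ((m ⬝ᵥ v : ℤ) : ℝ) :=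
  pairing_latticeVec m v

theorem latticeVec_mem_basisCone (i : Fin n) : latticeVec (b i) ∈ basisCone b :=
  Submodule.subset_span ⟨i, rfl⟩

theorem mem_dualMonoid_basisCone {m : CharLattice n} :
    m ∈ dualMonoid (basisCone b) ↔ ∀ i, 0 ≤ m.toAdd ⬝ᵥ b i := by
  refine ⟨fun h i => ?_, fun h v hv => pairing_nonneg_of_mem_hull ?_ hv⟩
  · have := h _ (latticeVec_mem_basisCone b i)
    rw [pairing_latticeVec_eq_dotProduct] at this
    exact_mod_cast this
  · rintro _ ⟨i, rfl⟩
    rw [pairing_latticeVec_eq_dotProduct]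
    exact_mod_cast h i

/-- The dual monoid of the cone generated by a `ℤ`-basis of `N` is free commutative. -/
noncomputable def dualMonoidEquiv :
    dualMonoid (basisCone b) ≃* Multiplicative (Fin n →₀ ℕ) where
  toFun m := Multiplicative.ofAdd (Finsupp.equivFunOnFinite.symm fun i => (m.1.toAdd ⬝ᵥ b i).toNat)
  invFun c := ⟨Multiplicative.ofAdd (∑ i, (c.toAdd i : ℤ) • dualVec b i),
    (mem_dualMonoid_basisCone b).2 fun i => by
      rw [toAdd_ofAdd, sum_smul_dualVec_dotProduct b fun i => (c.toAdd i : ℤ)]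
      exact Int.natCast_nonneg _⟩
  left_inv m := by
    refine Subtype.ext ?_
    conv_rhs => rw [← ofAdd_toAdd m.1, ← sum_dotProduct_smul_dualVec b m.1.toAdd]
    refine congrArg Multiplicative.ofAdd (Finset.sum_congr rfl fun i _ => ?_)
    have := (mem_dualMonoid_basisCone b).1 m.2 i
    exact congrArg (· • dualVec b i) (Int.toNat_of_nonneg this)
  right_inv c := by
    refine congrArg Multiplicative.ofAdd (Finsupp.ext fun i => ?_)
    change ((∑ i, (c.toAdd i : ℤ) • dualVec b i) ⬝ᵥ b i).toNat = c.toAdd i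
    rw [sum_smul_dualVec_dotProduct b fun i => (c.toAdd i : ℤ), Int.toNat_natCast]
  map_mul' x y := by
    refine congrArg Multiplicative.ofAdd (Finsupp.ext fun i => ?_)
    have h1 := (mem_dualMonoid_basisCone b).1 x.2 i
    have h2 := (mem_dualMonoid_basisCone b).1 y.2 i
    simp [add_dotProduct, Int.toNat_add h1 h2]

/-- The coordinate ring of the cone generated by a `ℤ`-basis of `N` is a polynomial ring. -/
noncomputable def coordRingEquiv : coordRing (basisCone b) ≃+* MvPolynomial (Fin n) ℂ :=
  (MonoidAlgebra.domCongr ℂ ℂ (dualMonoidEquiv b)).toRingEquiv.trans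
    (AddMonoidAlgebra.toMultiplicative ℂ (Fin n →₀ ℕ)).symm

instance : IsDomain (coordRing (basisCone b)) :=
  (coordRingEquiv b).toMulEquiv.isDomain _

instance : UniqueFactorizationMonoid (coordRing (basisCone b)) :=
  (coordRingEquiv b).symm.toMulEquiv.uniqueFactorizationMonoid inferInstance

instance : IsGCDMonoid (coordRing (basisCone b)) :=
  ⟨UniqueFactorizationMonoid.toGCDMonoid _⟩

end SoftToric

/-! ### Cartier data of an invertible sheaf -/

namespace SoftToric

variable {n : ℕ}

/-- Strong convexity makes the origin a face of the reference cone. -/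
theorem SmoothFan.bot_mem (Δ : SmoothFan n) : (⊥ : PointedCone ℝ (Fin n → ℝ)) ∈ Δ.cones := by
  refine Δ.face_mem _ Δ.reference ⊥ ⟨bot_le, fun {x y a} hx hy ha h => ?_⟩
  rw [Submodule.mem_bot] at h ⊢
  have h1 : -(a • x) ∈ PointedCone.hull ℝ
      (Set.range fun i : Fin n => latticeVec (Pi.single i 1 : Fin n → ℤ)) := by
    rw [neg_eq_of_add_eq_zero_right h]; exact hy
  have h2 : a • x ∈ PointedCone.hull ℝ
      (Set.range fun i : Fin n => latticeVec (Pi.single i 1 : Fin n → ℤ)) :=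
    Submodule.smul_mem _ (⟨a, ha.le⟩ : {c : ℝ // 0 ≤ c}) hx
  exact (smul_eq_zero.1 (Δ.stronglyConvex _ Δ.reference _ h2 h1)).resolve_left ha.ne'

variable {Δ : SmoothFan n}

instance : OrderBot Δ.Cone where
  bot := ⟨⊥, Δ.bot_mem⟩
  bot_le σ := (bot_le : (⊥ : PointedCone ℝ (Fin n → ℝ)) ≤ σ.1)

theorem SmoothFan.exists_isMax_ge (σ : Δ.Cone) :
    ∃ μ : Δ.Cone, σ ≤ μ ∧ IsMax μ := by
  obtain ⟨μ, h, hμ⟩ := Δ.finite.exists_le_maximal σ.2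
  exact ⟨⟨μ, hμ.prop⟩, h, fun ρ hρ => hμ.2 ρ.2 hρ⟩

theorem SmoothFan.exists_eq_basisCone {μ : Δ.Cone} (hμ : IsMax μ) :
    ∃ b : Module.Basis (Fin n) ℤ (Fin n → ℤ), μ.1 = basisCone b :=
  Δ.smooth μ.1 ⟨μ.2, fun ρ hρ h => hμ (b := ⟨ρ, hρ⟩) h⟩

theorem coordRes_injective {σ τ : PointedCone ℝ (Fin n → ℝ)} (h : τ ≤ σ) :
    Function.Injective (coordRes h) :=
  MonoidAlgebra.mapDomain_injective (Submonoid.inclusion_injective (dualMonoid_anti h))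

theorem coordRes_single {σ τ : PointedCone ℝ (Fin n → ℝ)} (h : τ ≤ σ) (m : dualMonoid σ) (c : ℂ) :
    coordRes h (MonoidAlgebra.single m c) =
      MonoidAlgebra.single (Submonoid.inclusion (dualMonoid_anti h) m) c :=
  MonoidAlgebra.mapDomain_single

theorem coordRes_of {σ τ : PointedCone ℝ (Fin n → ℝ)} (h : τ ≤ σ) (m : dualMonoid σ) :
    coordRes h (MonoidAlgebra.of ℂ _ m) =
      MonoidAlgebra.of ℂ _ (Submonoid.inclusion (dualMonoid_anti h) m) :=
  coordRes_single h m 1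

/-- The Picard argument is needed only over a maximal cone, where the coordinate ring is a
polynomial ring; smaller charts inherit a generator by restriction. -/
theorem exists_generators {L : Δ.toricVariety.Modules} (hL : IsInvertibleSheaf L) (σ : Δ.Cone) :
    ∃ s : chartSections L σ, Function.Bijective fun a : coordRing σ.1 => a • s := by
  obtain ⟨μ, hσμ, hμ⟩ := SmoothFan.exists_isMax_ge σ
  obtain ⟨b, hb⟩ := SmoothFan.exists_eq_basisCone hμ
  have : IsDomain (coordRing μ.1) := by rw [hb]; infer_instance
  have : IsGCDMonoid (coordRing μ.1) := by rw [hb]; infer_instance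
  obtain ⟨s, hs⟩ := exists_bijective_smul_chartSections L hL μ
  exact ⟨_, bijective_smul_chartRestrict L hL hσμ s hs⟩

theorem isUnit_of_bijective_smul {A F : Type*} [CommRing A] [AddCommGroup F] [Module A F] {s t : F}
    (hs : Function.Bijective fun a : A => a • s) (ht : Function.Bijective fun a : A => a • t) :
    ∃ a a' : A, a * a' = 1 ∧ s = a • t ∧ t = a' • s := by
  obtain ⟨a, ha⟩ := ht.2 s
  obtain ⟨a', ha'⟩ := hs.2 t
  refine ⟨a, a', ht.1 ?_, ha.symm, ha'.symm⟩
  dsimp only at ha ha' ⊢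
  rw [mul_comm, mul_smul, ha, ha', one_smul]

/-- Elements in the image of `coordRes` are supported on `M_σ`. This brings identities found on the
torus back to larger charts. -/
theorem mem_dualMonoid_of_coordRes_eq {σ τ : PointedCone ℝ (Fin n → ℝ)} (h : τ ≤ σ)
    {a : coordRing σ} {m : dualMonoid τ} (ha : coordRes h a = MonoidAlgebra.of ℂ _ m) :
    ∃ hm : m.1 ∈ dualMonoid σ, a = MonoidAlgebra.of ℂ _ ⟨m.1, hm⟩ := by
  suffices hm : m.1 ∈ dualMonoid σ from
    ⟨hm, coordRes_injective h (by rw [ha, coordRes_of]; rfl)⟩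
  by_contra hm
  have h1 : (coordRes h a).coeff m = 0 :=
    Finsupp.mapDomain_of_notMem_range _ _
      (by rintro ⟨x, rfl⟩; exact hm x.2)
  rw [ha, MonoidAlgebra.of_apply, MonoidAlgebra.coeff_single, Finsupp.single_eq_same] at h1
  exact one_ne_zero h1

/-- Cartier data of an invertible sheaf on `Y(Δ)`: generators `s σ` of the modules of sections over
the charts which differ from each other by characters. -/
structure CartierData (L : Δ.toricVariety.Modules) where
  gen : ∀ σ : Δ.Cone, chartSections L σ
  bijective : ∀ σ : Δ.Cone, Function.Bijective fun a : coordRing σ.1 => a • gen σ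
  char : Δ.Cone → CharLattice n
  div_mem : ∀ {τ σ : Δ.Cone}, τ ≤ σ → char σ / char τ ∈ dualMonoid τ.1
  div_mem' : ∀ {τ σ : Δ.Cone}, τ ≤ σ → char τ / char σ ∈ dualMonoid τ.1
  restrict : ∀ {τ σ : Δ.Cone} (h : τ ≤ σ), chartRestrict L h (gen σ) =
    MonoidAlgebra.of ℂ (dualMonoid τ.1) ⟨_, div_mem h⟩ • gen τ

/-- Every generator is compared with one fixed generator `s₀` on the torus, so the characters come
from a single family indexed by cones. -/
theorem IsInvertibleSheaf.nonempty_cartierData {L : Δ.toricVariety.Modules}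
    (hL : IsInvertibleSheaf L) : Nonempty (CartierData L) := by
  obtain ⟨s₀, hs₀⟩ := exists_generators hL (⊥ : Δ.Cone)
  -- The ratio to `s₀` is a unit, hence a constant `c` times a character; scaling the generator by
  -- `c⁻¹` leaves the character alone.
  have hgen (σ : Δ.Cone) : ∃ (s : chartSections L σ) (m : dualMonoid (⊥ : Δ.Cone).1),
      (Function.Bijective fun a : coordRing σ.1 => a • s) ∧
      chartRestrict L (bot_le : ⊥ ≤ σ) s = MonoidAlgebra.of ℂ _ m • s₀ := by
    obtain ⟨s, hs⟩ := exists_generators hL σ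
    obtain ⟨a, a', haa', ha, -⟩ := isUnit_of_bijective_smul
      (bijective_smul_chartRestrict L hL (bot_le : ⊥ ≤ σ) s hs) hs₀
    obtain ⟨m, c, hc, rfl⟩ := MonoidAlgebra.exists_eq_single_of_mul_eq_one haa'
    have hunit : IsUnit (MonoidAlgebra.single (1 : dualMonoid σ.1) c⁻¹) :=
      IsUnit.of_mul_eq_one (MonoidAlgebra.single 1 c) (by
        rw [MonoidAlgebra.single_mul_single, inv_mul_cancel₀ hc]; rfl)
    refine ⟨MonoidAlgebra.single (1 : dualMonoid σ.1) c⁻¹ • s, m, ?_, ?_⟩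
    · simp only [smul_smul]
      exact hs.comp (IsUnit.isUnit_iff_mulRight_bijective.1 hunit)
    · rw [chartRestrict_smul, ha, coordRes_single, smul_smul, MonoidAlgebra.single_mul_single,
        inv_mul_cancel₀ hc, map_one, one_mul]
      rfl
  choose s m hs hm using hgen
  have hbot (x : CharLattice n) : x ∈ dualMonoid (⊥ : Δ.Cone).1 := fun v hv => by
    rw [(Submodule.mem_bot _).1 hv, pairing_zero_right]
  have key {τ σ : Δ.Cone} (h : τ ≤ σ) : ∃ hd : (m σ).1 / (m τ).1 ∈ dualMonoid τ.1,
      (m τ).1 / (m σ).1 ∈ dualMonoid τ.1 ∧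
      chartRestrict L h (s σ) = MonoidAlgebra.of ℂ (dualMonoid τ.1) ⟨_, hd⟩ • s τ := by
    obtain ⟨a, a', haa', ha, -⟩ := isUnit_of_bijective_smul
      (bijective_smul_chartRestrict L hL h _ (hs σ)) (hs τ)
    have h1 : MonoidAlgebra.of ℂ _ (m σ) =
        coordRes (bot_le : ⊥ ≤ τ) a * MonoidAlgebra.of ℂ _ (m τ) := hs₀.1 (by
      dsimp only
      rw [← hm σ, mul_smul, ← hm τ, ← chartRestrict_smul, ← ha, chartRestrict_chartRestrict])
    have h2 : coordRes (bot_le : ⊥ ≤ τ) a = MonoidAlgebra.of ℂ _ ⟨_, hbot ((m σ).1 / (m τ).1)⟩ := by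
      rw [← mul_one (coordRes _ a), ← map_one (MonoidAlgebra.of ℂ (dualMonoid (⊥ : Δ.Cone).1)),
        show (1 : dualMonoid (⊥ : Δ.Cone).1) = m τ * ⟨_, hbot (m τ).1⁻¹⟩ from
          Subtype.ext (mul_inv_cancel _).symm, map_mul, ← mul_assoc, ← h1, ← map_mul]
      exact congrArg _ (Subtype.ext (div_eq_mul_inv _ _).symm)
    have h3 : coordRes (bot_le : ⊥ ≤ τ) a' =
        MonoidAlgebra.of ℂ _ ⟨_, hbot ((m τ).1 / (m σ).1)⟩ := by
      have h4 : coordRes (bot_le : ⊥ ≤ τ) a * coordRes (bot_le : ⊥ ≤ τ) a' = 1 := by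
        rw [← map_mul, haa', map_one]
      rw [← mul_one (coordRes _ a'), ← map_one (MonoidAlgebra.of ℂ (dualMonoid (⊥ : Δ.Cone).1)),
        show (1 : dualMonoid (⊥ : Δ.Cone).1) = ⟨_, hbot ((m σ).1 / (m τ).1)⟩ *
          ⟨_, hbot ((m τ).1 / (m σ).1)⟩ from
          Subtype.ext ((div_mul_div_cancel _ _ _).trans (div_self' _)).symm, map_mul, ← h2,
        ← mul_assoc,
          mul_comm (coordRes _ a'), h4, one_mul]
    -- The ratio `a` and its inverse `a'` both live on `U_τ`, so the character and its inverse both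
    -- lie in `M_τ`.
    obtain ⟨hd, had⟩ := mem_dualMonoid_of_coordRes_eq _ h2
    obtain ⟨hd', -⟩ := mem_dualMonoid_of_coordRes_eq _ h3
    exact ⟨hd, hd', had ▸ ha⟩
  exact ⟨⟨s, hs, fun σ => (m σ).1, fun h => (key h).1, fun h => (key h).2.1,
    fun h => (key h).2.2⟩⟩

end SoftToric

/-! ### Base change, and modules glued by monomials -/

namespace SoftToric

section BaseChange

variable {A B : Type} [Ring A] [Ring B] (φ : A →+* B)

/-- The isomorphism `B ⊗_A A ≃ B`. -/
noncomputable def BaseChange.selfEquiv : BaseChange φ A ≃ₗ[B] B :=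
  let f : B ⊗[ℤ] A →ₗ[B] B := TensorProduct.AlgebraTensorModule.lift
    { toFun := fun b => (AddMonoidHom.mulLeft b).toIntLinearMap ∘ₗ φ.toAddMonoidHom.toIntLinearMap
      map_add' := fun b c => by ext x; simp [add_mul]
      map_smul' := fun b c => by ext x; simp [mul_assoc] }
  have hf (b : B) (x : A) : f (b ⊗ₜ x) = b * φ x := rfl
  LinearEquiv.ofLinearMap
    (Submodule.liftQ _ f (Submodule.span_le.2 (by
      rintro _ ⟨p, rfl⟩
      simp [hf])))
    (LinearMap.toSpanSingleton B (BaseChange φ A) (.tmul φ 1 1))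
    (by ext; simp [BaseChange.tmul, hf])
    (by
      refine Submodule.linearMap_qext _ ?_
      ext x
      have h : BaseChange.tmul φ (φ x) (1 : A) = BaseChange.tmul φ 1 x := by
        refine (Submodule.Quotient.eq _).2 (Submodule.subset_span ⟨(x, 1), ?_⟩)
        simp
      simp only [BaseChange.tmul] at h
      simp [BaseChange.tmul, hf, ← h, ← Submodule.Quotient.mk_smul, TensorProduct.smul_tmul'])

@[simp]
theorem BaseChange.selfEquiv_tmul (b : B) (x : A) : selfEquiv φ (.tmul φ b x) = b * φ x := rfl

end BaseChange

namespace SoftScheme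

variable {n : ℕ} {Δ : SmoothFan n} (Y : SoftScheme Δ)

theorem res_single {τ σ : Δ.Cone} (h : τ ≤ σ) (m : Y.monoid σ) (c : ℂ) :
    Y.res h (MonoidAlgebra.single m c) =
      MonoidAlgebra.single (Submonoid.inclusion (Y.anti h) m) c :=
  MonoidAlgebra.mapDomain_single

theorem ringProj_single {σ : Δ.Cone} (m : Y.monoid σ) (c : ℂ) :
    Y.ringProj σ (MonoidAlgebra.single m c) = MonoidAlgebra.single (Y.monoidProj σ m) c :=
  MonoidAlgebra.mapDomain_single

theorem res_res {ρ τ σ : Δ.Cone} (h : ρ ≤ τ) (h' : τ ≤ σ) (x : Y.ring σ) :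
    Y.res h (Y.res h' x) = Y.res (h.trans h') x := by
  rw [← RingHom.comp_apply, res, res, ← MonoidAlgebra.mapDomainRingHom_comp]
  rfl

theorem ringProj_res {τ σ : Δ.Cone} (h : τ ≤ σ) (x : Y.ring σ) :
    Y.ringProj τ (Y.res h x) = coordRes h (Y.ringProj σ x) := by
  rw [← RingHom.comp_apply, ← RingHom.comp_apply]
  simp only [res, ringProj, coordRes, ← MonoidAlgebra.mapDomainRingHom_comp]
  rfl

/-- A family of words `w` such that `w σ / w τ` is invertible in `M̆_τ` for every face `τ`
of `σ`. -/
structure IsMultiplicative (w : Δ.Cone → EdgePathMonoid n) : Prop where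
  mem : ∀ {τ σ : Δ.Cone}, τ ≤ σ → w σ * (w τ)⁻¹ ∈ Y.monoid τ
  mem' : ∀ {τ σ : Δ.Cone}, τ ≤ σ → w τ * (w σ)⁻¹ ∈ Y.monoid τ

variable {Y} {w : Δ.Cone → EdgePathMonoid n} (hw : Y.IsMultiplicative w)

/-- The monomial of `R̆_τ` given by the word `w σ / w τ`. -/
noncomputable def IsMultiplicative.transition {τ σ : Δ.Cone} (h : τ ≤ σ) : Y.ring τ :=
  MonoidAlgebra.of ℂ (Y.monoid τ) ⟨_, hw.mem h⟩

theorem IsMultiplicative.isUnit_transition {τ σ : Δ.Cone} (h : τ ≤ σ) :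
    IsUnit (hw.transition h) := by
  refine IsUnit.map (MonoidAlgebra.of ℂ (Y.monoid τ)) ⟨⟨⟨_, hw.mem h⟩, ⟨_, hw.mem' h⟩,
    Subtype.ext ?_, Subtype.ext ?_⟩, rfl⟩
  · change w σ * (w τ)⁻¹ * (w τ * (w σ)⁻¹) = 1
    group
  · change w τ * (w σ)⁻¹ * (w σ * (w τ)⁻¹) = 1
    group

theorem IsMultiplicative.res_transition_mul {ρ τ σ : Δ.Cone} (h : ρ ≤ τ) (h' : τ ≤ σ) :
    Y.res h (hw.transition h') * hw.transition h = hw.transition (h.trans h') := by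
  rw [transition, MonoidAlgebra.of_apply, res_single, transition, MonoidAlgebra.of_apply,
    MonoidAlgebra.single_mul_single, mul_one]
  refine congrArg (MonoidAlgebra.of ℂ (Y.monoid ρ)) (Subtype.ext ?_)
  change w σ * (w τ)⁻¹ * (w τ * (w ρ)⁻¹) = _
  group

/-- The invertible module on `Y̆(Δ)` which is free on every chart and glued by the monomials
`w σ / w τ`. -/
noncomputable def IsMultiplicative.leftModule : LeftModule Y where
  sec σ := Y.ring σ
  -- Left-linear endomorphisms of the ring are right multiplications. This fixes the order `w σ * (w
  -- τ)⁻¹`, for which the products in the cocycle identity telescope.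
  glue {_ _} h := LinearMap.toSpanSingleton _ _ (hw.transition h.le) ∘ₗ
    (BaseChange.selfEquiv (Y.res h.le)).toLinearMap
  glue_comp h h' s := by
    simp [res_res, mul_assoc, hw.res_transition_mul]

theorem IsMultiplicative.isInvertible_leftModule : hw.leftModule.IsInvertible := by
  refine ⟨fun σ => ⟨LinearEquiv.refl _ _⟩, fun {τ σ} h => ?_⟩
  refine Function.Bijective.comp (f := (BaseChange.selfEquiv (Y.res h.le)))
    (g := fun b : Y.ring τ => b * hw.transition h.le) ?_ (LinearEquiv.bijective _)
  exact IsUnit.isUnit_iff_mulRight_bijective.1 (hw.isUnit_transition h.le)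

/-- After abelianization each chart module is free on `1`, which is sent to `D.gen σ`. Compatibility
holds because the image of the monomial `w σ * (w τ)⁻¹` is the transition character `D.char σ /
D.char τ`. -/
theorem IsMultiplicative.extends_leftModule {L : Δ.toricVariety.Modules} (D : CartierData L)
    (hD : ∀ σ, edgeProj n (w σ) = D.char σ) : hw.leftModule.Extends L := by
  refine ⟨fun σ => (BaseChange.selfEquiv (Y.ringProj σ)).trans (LinearEquiv.ofBijective
    (LinearMap.toSpanSingleton _ _ (D.gen σ)) (D.bijective σ)), fun {τ σ} h s => ?_⟩
  have h1 : Y.ringProj τ (hw.transition h.le) =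
      MonoidAlgebra.of ℂ (dualMonoid τ.1) ⟨_, D.div_mem h.le⟩ := by
    rw [transition, MonoidAlgebra.of_apply, ringProj_single]
    refine congrArg (MonoidAlgebra.of ℂ (dualMonoid τ.1)) (Subtype.ext ?_)
    change edgeProj n (w σ * (w τ)⁻¹) = _
    rw [map_mul, map_inv, hD, hD]
    exact (div_eq_mul_inv _ _).symm
  change (1 * Y.ringProj τ (1 * Y.res h.le s * hw.transition h.le)) • D.gen τ =
    chartRestrict L h.le ((1 * Y.ringProj σ s) • D.gen σ)
  rw [one_mul, one_mul, one_mul, map_mul, h1, chartRestrict_smul, D.restrict h.le, mul_smul]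
  exact congrArg (· • _ • D.gen τ) (Y.ringProj_res h.le s)

end SoftScheme

end SoftToric

/-! ### The softening -/

namespace SoftToric

variable {n : ℕ}

theorem edgeProj_surjective : Function.Surjective (edgeProj n) := fun m => by
  refine ⟨(List.ofFn fun i => (FreeGroup.of i) ^ (m.toAdd i)).prod, ?_⟩
  rw [map_list_prod, List.map_ofFn, List.prod_ofFn]
  simp only [Function.comp_def, map_zpow, edgeProj, FreeGroup.lift_apply_of, ← ofAdd_zsmul]
  rw [← ofAdd_sum]
  refine congrArg Multiplicative.ofAdd ?_
  ext j
  simp [Finset.sum_apply, Pi.single_apply]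
  rfl

/-- If every element of a generating set with invertible image in `M_σ` is invertible in the
submonoid it generates, then so is every element of that submonoid. -/
theorem inv_mem_closure_of_generators {σ : PointedCone ℝ (Fin n → ℝ)} {S : Set (EdgePathMonoid n)}
    (hS : ∀ p ∈ S, edgeProj n p ∈ dualMonoid σ)
    (hinv : ∀ p ∈ S, (edgeProj n p)⁻¹ ∈ dualMonoid σ → p⁻¹ ∈ Submonoid.closure S) :
    ∀ p ∈ Submonoid.closure S, (edgeProj n p)⁻¹ ∈ dualMonoid σ → p⁻¹ ∈ Submonoid.closure S := by
  have hle : Submonoid.closure S ≤ (dualMonoid σ).comap (edgeProj n) := Submonoid.closure_le.2 hS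
  intro p hp
  induction hp using Submonoid.closure_induction with
  | mem x hx => exact hinv x hx
  | one => intro _; rw [inv_one]; exact one_mem _
  | mul x y hx hy hx' hy' =>
    intro h
    rw [mul_inv_rev]
    rw [map_mul, mul_inv] at h
    refine mul_mem (hy' ?_) (hx' ?_)
    · have := mul_mem h (hle hx)
      rwa [mul_right_comm, inv_mul_cancel, one_mul] at this
    · have := mul_mem h (hle hy)
      rwa [mul_assoc, inv_mul_cancel, mul_one] at this

namespace SoftScheme

variable {Δ : SmoothFan n} (Y : SoftScheme Δ) (w : Δ.Cone → EdgePathMonoid n)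

/-- The words `w σ / w ρ` for cones `σ`, `ρ` with face `τ`. -/
def quotients (τ : Δ.Cone) : Set (EdgePathMonoid n) :=
  {p | ∃ σ ρ : Δ.Cone, τ ≤ σ ∧ τ ≤ ρ ∧ p = w σ * (w ρ)⁻¹}

theorem quotients_finite (τ : Δ.Cone) : (quotients w τ).Finite := by
  have : Finite Δ.Cone := Δ.finite
  refine (Set.finite_range fun p : Δ.Cone × Δ.Cone => w p.1 * (w p.2)⁻¹).subset ?_
  rintro _ ⟨σ, ρ, -, -, rfl⟩
  exact ⟨(σ, ρ), rfl⟩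

/-- Only `τ` itself contains `τ`, so every quotient is `w τ * (w τ)⁻¹`. Hence softening leaves the
fundamental charts alone. -/
theorem closure_quotients_of_isMax {τ : Δ.Cone} (hτ : IsMax τ) :
    Submonoid.closure (quotients w τ) = ⊥ := by
  refine le_bot_iff.1 (Submonoid.closure_le.2 ?_)
  rintro _ ⟨σ, ρ, hσ, hρ, rfl⟩
  rw [hτ.eq_of_ge hσ, hτ.eq_of_ge hρ]
  exact mul_inv_cancel _

variable (hw : ∀ {τ σ : Δ.Cone}, τ ≤ σ → edgeProj n (w σ) / edgeProj n (w τ) ∈ dualMonoid τ.1 ∧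
  edgeProj n (w τ) / edgeProj n (w σ) ∈ dualMonoid τ.1)

-- The quotient of `w σ` by `w ρ` is compared through `w τ`, where each factor has character in
-- `M_τ`.
include hw in
theorem edgeProj_mem_of_mem_quotients {τ : Δ.Cone} {p : EdgePathMonoid n}
    (hp : p ∈ quotients w τ) : edgeProj n p ∈ dualMonoid τ.1 := by
  obtain ⟨σ, ρ, hσ, hρ, rfl⟩ := hp
  rw [map_mul, map_inv, ← div_eq_mul_inv, ← div_mul_div_cancel _ (edgeProj n (w τ))]
  exact mul_mem (hw hσ).1 (hw hρ).2

theorem inv_mem_quotients {τ : Δ.Cone} {p : EdgePathMonoid n} (hp : p ∈ quotients w τ) :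
    p⁻¹ ∈ quotients w τ := by
  obtain ⟨σ, ρ, hσ, hρ, rfl⟩ := hp
  exact ⟨ρ, σ, hρ, hσ, by group⟩

/-- The softening of `Y̆(Δ)` obtained by inverting the words `w σ / w ρ` on the common faces of `σ`
and `ρ`. -/
def soften : SoftScheme Δ where
  monoid τ := Submonoid.closure (Y.monoid τ ∪ quotients w τ)
  -- Pairs of cones above `σ` are also pairs above `τ`; this is why all pairs are used, and not only
  -- those involving `τ` itself.
  anti {τ σ} h := Submonoid.closure_mono (Set.union_subset_union (Y.anti h)
    fun _ ⟨α, β, hα, hβ, hp⟩ => ⟨α, β, h.trans hα, h.trans hβ, hp⟩)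
  admissible τ := by
    have hadm := Y.admissible τ
    have hS : ∀ p ∈ (Y.monoid τ : Set _) ∪ quotients w τ, edgeProj n p ∈ dualMonoid τ.1 := by
      rintro p (hp | hp)
      · rw [← hadm.map_eq]; exact ⟨p, hp, rfl⟩
      · exact edgeProj_mem_of_mem_quotients w hw hp
    refine ⟨?_, le_antisymm ?_ ?_, inv_mem_closure_of_generators hS ?_⟩
    · rw [Submonoid.closure_union, Submonoid.closure_eq]
      exact hadm.fg.sup ⟨(quotients_finite w τ).toFinset, by simp⟩
    · rw [Submonoid.map_le_iff_le_comap]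
      exact Submonoid.closure_le.2 hS
    · rw [← hadm.map_eq]
      exact Submonoid.monotone_map fun p hp => Submonoid.subset_closure (Or.inl hp)
    · rintro p (hp | hp) h
      · exact Submonoid.subset_closure (Or.inl (hadm.inv_mem p hp h))
      · exact Submonoid.subset_closure (Or.inr (inv_mem_quotients w hp))
  free_of_isMax τ hτ := by
    rw [Submonoid.closure_union, Submonoid.closure_eq,
      closure_quotients_of_isMax w hτ, sup_bot_eq]
    exact Y.free_of_isMax τ hτ
  zero_eq_top τ hτ := by
    refine top_le_iff.1 fun p _ => Submonoid.subset_closure (Or.inl ?_)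
    rw [Y.zero_eq_top τ hτ]
    trivial

theorem isSoftening_soften : (Y.soften w hw).IsSoftening Y := by
  refine ⟨fun τ hτ => ?_, fun τ _ p hp => Submonoid.subset_closure (Or.inl hp)⟩
  change Submonoid.closure _ = _
  rw [Submonoid.closure_union, Submonoid.closure_eq,
    closure_quotients_of_isMax w hτ, sup_bot_eq]

theorem isMultiplicative_soften : (Y.soften w hw).IsMultiplicative w :=
  ⟨fun h => Submonoid.subset_closure (Or.inr ⟨_, _, h, le_rfl, rfl⟩),
    fun h => Submonoid.subset_closure (Or.inr ⟨_, _, le_rfl, h, rfl⟩)⟩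

theorem exists_softening_extends {L : Δ.toricVariety.Modules} (hL : IsInvertibleSheaf L) :
    ∃ Y' : SoftScheme Δ, Y'.IsSoftening Y ∧ ∃ E : LeftModule Y', E.IsInvertible ∧ E.Extends L := by
  obtain ⟨D⟩ := hL.nonempty_cartierData
  choose w hw using fun σ => edgeProj_surjective (D.char σ)
  have hw' {τ σ : Δ.Cone} (h : τ ≤ σ) : edgeProj n (w σ) / edgeProj n (w τ) ∈ dualMonoid τ.1 ∧
      edgeProj n (w τ) / edgeProj n (w σ) ∈ dualMonoid τ.1 := by
    rw [hw, hw]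
    exact ⟨D.div_mem h, D.div_mem' h⟩
  have hmul := Y.isMultiplicative_soften w hw'
  exact ⟨Y.soften w hw', Y.isSoftening_soften w hw', hmul.leftModule, hmul.isInvertible_leftModule,
    hmul.extends_leftModule D hw⟩

end SoftScheme

end SoftToric

/-! ### Free submonoids of free groups -/

namespace Magnus

variable {ι α : Type*}

/-- Noncommutative formal power series, as functions on words. -/
abbrev Series (α : Type*) : Type _ := List α → ℤ

/-- The inverse of left multiplication by `1 + ∑ c a • a`. -/
def unshift (c : α → ℤ) (f : Series α) : Series α
  | [] => f []
  | a :: w => f (a :: w) - c a * unshift c f w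

/-- Left multiplication by `1 + ∑ c a • a` on formal power series. -/
def shiftEquiv (c : α → ℤ) : Series α ≃ₗ[ℤ] Series α where
  toFun f
    | [] => f []
    | a :: w => f (a :: w) + c a * f w
  map_add' f g := by
    ext w
    cases w with
    | nil => rfl
    | cons a w => simp only [Pi.add_apply]; ring
  map_smul' r f := by
    ext w
    cases w with
    | nil => rfl
    | cons a w => simp only [Pi.smul_apply, smul_eq_mul, RingHom.id_apply]; ring
  invFun := unshift c
  left_inv f := by
    ext w
    induction w with
    | nil => rfl
    | cons a w ih => rw [unshift, ih]; ring
  right_inv f := by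
    ext w
    cases w with
    | nil => rfl
    | cons a w => simp [unshift]

/-- An automorphism of formal power series acts to first order by left multiplication by
`1 + ∑ c a • a`. -/
def FirstOrder (e : Series α ≃ₗ[ℤ] Series α) (c : α → ℤ) : Prop :=
  ∀ (d : ℕ) (f : Series α), (∀ w, w.length < d → f w = 0) →
    (∀ w, w.length ≤ d → e f w = f w) ∧
    ∀ a w, w.length = d → e f (a :: w) = f (a :: w) + c a * f w

theorem firstOrder_one : FirstOrder (1 : Series α ≃ₗ[ℤ] Series α) 0 :=
  fun _ _ _ => ⟨fun _ _ => rfl, fun _ _ _ => by simp⟩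

/-- Since `e'` does not change the coefficients up to degree `d`, the linear term of `e` meets the
same leading part, and the linear terms add. -/
theorem FirstOrder.mul {e e' : Series α ≃ₗ[ℤ] Series α} {c c' : α → ℤ} (h : FirstOrder e c)
    (h' : FirstOrder e' c') : FirstOrder (e * e') (c + c') := fun d f hf => by
  obtain ⟨h1, h2⟩ := h' d f hf
  obtain ⟨h3, h4⟩ := h d (e' f) fun w hw => (h1 w hw.le).trans (hf w hw)
  refine ⟨fun w hw => (h3 w hw).trans (h1 w hw), fun a w hw => ?_⟩
  rw [LinearEquiv.mul_apply, h4 a w hw, h2 a w hw, h1 w hw.le, Pi.add_apply]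
  ring

theorem firstOrder_shiftEquiv (c : α → ℤ) : FirstOrder (shiftEquiv c) c := fun d f hf => by
  refine ⟨fun w hw => ?_, fun a w _ => rfl⟩
  cases w with
  | nil => rfl
  | cons a w =>
    change f (a :: w) + c a * f w = _
    rw [hf w (by simpa using hw), mul_zero, add_zero]

theorem firstOrder_shiftEquiv_inv (c : α → ℤ) : FirstOrder (shiftEquiv c)⁻¹ (-c) :=
    fun d f hf => by
  have h0 (w : List α) : w.length ≤ d → unshift c f w = f w := by
    induction w with
    | nil => exact fun _ => rfl
    | cons a w ih =>
      intro hw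
      have hw' : w.length < d := by simpa using hw
      rw [unshift, ih hw'.le, hf w hw', mul_zero, sub_zero]
  refine ⟨h0, fun a w hw => ?_⟩
  change unshift c f (a :: w) = _
  rw [unshift, h0 w hw.le, Pi.neg_apply]
  ring

/-- The Magnus representation of a free group on formal power series, for a given homomorphism to
the lattice of linear forms. -/
def rep (χ : FreeGroup ι →* Multiplicative (α → ℤ)) : FreeGroup ι →* (Series α ≃ₗ[ℤ] Series α) :=
  FreeGroup.lift fun i => shiftEquiv (χ (FreeGroup.of i)).toAdd

variable (χ : FreeGroup ι →* Multiplicative (α → ℤ))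

/-- Linear terms add under composition, so they are determined by the generators, where they agree
with `χ` by construction. -/
theorem firstOrder_rep (g : FreeGroup ι) : FirstOrder (rep χ g) (χ g).toAdd := by
  induction g using FreeGroup.induction_on with
  | C1 => rw [map_one, map_one]; exact firstOrder_one
  | of i => rw [rep, FreeGroup.lift_apply_of]; exact firstOrder_shiftEquiv _
  | inv_of i _ =>
    rw [map_inv, map_inv, rep, FreeGroup.lift_apply_of]; exact firstOrder_shiftEquiv_inv _
  | mul g h hg hh => rw [map_mul, map_mul]; exact hg.mul hh

variable (y : α → FreeGroup ι)

/-- The homomorphism from the free monoid given by the operators `y i - 1`. -/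
def difference : FreeMonoid α →* Module.End ℤ (Series α) :=
  FreeMonoid.lift fun i => (rep χ (y i)).toLinearMap - 1

/-- The homomorphism of monoids from the free monoid to its monoid algebra sending each letter `i`
to `i + 1`. -/
noncomputable def letterAddOne (α : Type*) : FreeMonoid α →* MonoidAlgebra ℤ (FreeMonoid α) :=
  FreeMonoid.lift fun i => MonoidAlgebra.of ℤ (FreeMonoid α) (FreeMonoid.of i) + 1

/-- The algebra endomorphism `i ↦ i - 1` sends `i + 1` back to `i` and so recovers the word. -/
theorem letterAddOne_injective : Function.Injective (letterAddOne α) := by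
  have hX (i : α) : MonoidAlgebra.lift ℤ (MonoidAlgebra ℤ (FreeMonoid α)) (FreeMonoid α)
      (FreeMonoid.lift fun i => MonoidAlgebra.of ℤ (FreeMonoid α) (FreeMonoid.of i) - 1)
      (MonoidAlgebra.of ℤ (FreeMonoid α) (FreeMonoid.of i)) =
        MonoidAlgebra.of ℤ (FreeMonoid α) (FreeMonoid.of i) - 1 :=
    (MonoidAlgebra.lift_of _ _).trans (FreeMonoid.lift_eval_of _ _)
  generalize MonoidAlgebra.lift ℤ (MonoidAlgebra ℤ (FreeMonoid α)) (FreeMonoid α)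
      (FreeMonoid.lift fun i => MonoidAlgebra.of ℤ (FreeMonoid α) (FreeMonoid.of i) - 1) = Ψ at hX
  have h : (Ψ : MonoidAlgebra ℤ (FreeMonoid α) →* MonoidAlgebra ℤ (FreeMonoid α)).comp
      (letterAddOne α) = MonoidAlgebra.of ℤ (FreeMonoid α) := by
    refine FreeMonoid.hom_eq fun i => ?_
    change Ψ (letterAddOne α (FreeMonoid.of i)) = _
    rw [letterAddOne, FreeMonoid.lift_eval_of, map_add, map_one, hX, sub_add_cancel]
  intro u v huv
  refine MonoidAlgebra.of_injective (R := ℤ) ?_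
  rw [← h]
  exact congrArg Ψ huv

/-- Substituting `y i - 1` for the letter `i` turns `i + 1` into `y i`. Injectivity on words in the
`y i` thus reduces to independence of the products of differences. -/
theorem lift_difference_letterAddOne (u : FreeMonoid α) :
    MonoidAlgebra.lift ℤ (Module.End ℤ (Series α)) (FreeMonoid α) (difference χ y)
      (letterAddOne α u) = (rep χ (FreeMonoid.lift y u)).toLinearMap := by
  induction u using FreeMonoid.inductionOn' with
  | one => rw [map_one, map_one, map_one, map_one]; rfl
  | of_mul i u ih =>
    rw [map_mul, map_mul, ih, map_mul, map_mul, letterAddOne, FreeMonoid.lift_eval_of,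
      FreeMonoid.lift_eval_of, map_add, map_one, MonoidAlgebra.lift_of, difference,
      FreeMonoid.lift_eval_of, sub_add_cancel]
    rfl

variable [DecidableEq α] (hy : ∀ i, χ (y i) = Multiplicative.ofAdd (Pi.single i 1))

-- Each `y i - 1` raises the order by one and acts on the leading term as left multiplication by the
-- letter `i`. Applied to the series `1`, the product along `u` therefore has leading term `u`.
include hy in
theorem difference_apply (u : FreeMonoid α) (w : List α) (hw : w.length ≤ u.toList.length) :
    difference χ y u (Pi.single [] 1) w = if w = u.toList then 1 else 0 := by
  induction u using FreeMonoid.inductionOn' generalizing w with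
  | one =>
    rw [map_one, Module.End.one_apply, Pi.single_apply]
    rfl
  | of_mul i u ih =>
    rw [map_mul, Module.End.mul_apply]
    set f := difference χ y u (Pi.single [] 1) with hf
    have hlt (w : List α) (hw : w.length < u.toList.length) : f w = 0 := by
      rw [ih w hw.le, if_neg (by rintro rfl; exact hw.false)]
    obtain ⟨h1, h2⟩ := firstOrder_rep χ (y i) _ f hlt
    have h3 : difference χ y (FreeMonoid.of i) f w = rep χ (y i) f w - f w := by
      rw [difference, FreeMonoid.lift_eval_of]; rfl
    rw [h3]
    rcases Nat.lt_or_ge u.toList.length w.length with h | h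
    · obtain _ | ⟨a, w⟩ := w
      · simp at h
      have hw' : w.length = u.toList.length := by simp at h hw; omega
      rw [h2 a w hw', hy, toAdd_ofAdd, Pi.single_apply, ih w hw'.le, FreeMonoid.toList_of_mul]
      by_cases ha : a = i <;> by_cases hw : w = u.toList <;> simp [ha, hw]
    -- In degrees up to the length of `u` the operator `y i` fixes the coefficients of `f`, and `w`
    -- is too short to be `i` followed by `u`.
    · rw [h1 w h, sub_self, if_neg]
      rintro rfl
      simp at h

-- The coefficient of a shortest word `u` in the support can be read off at `u`: every other word
-- there is at least as long and contributes `0`.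
include hy in
theorem lift_difference_injective :
    Function.Injective (MonoidAlgebra.lift ℤ (Module.End ℤ (Series α)) (FreeMonoid α)
      (difference χ y)) := by
  refine (injective_iff_map_eq_zero _).2 fun p hp => ?_
  by_contra hne
  obtain ⟨u, hu, hmin⟩ := p.coeff.support.exists_min_image (fun u => u.toList.length)
    (Finsupp.support_nonempty_iff.2 (by simpa using hne))
  have h1 := congrFun (LinearMap.congr_fun hp (Pi.single [] 1)) u.toList
  rw [MonoidAlgebra.lift_apply, Finsupp.sum, LinearMap.sum_apply, Finset.sum_apply,
    Finset.sum_eq_single u] at h1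
  · rw [LinearMap.smul_apply, Pi.smul_apply, difference_apply χ y hy u _ le_rfl, if_pos rfl] at h1
    exact Finsupp.mem_support_iff.1 hu (by simpa using h1)
  · intro v hv hvu
    rw [LinearMap.smul_apply, Pi.smul_apply, difference_apply χ y hy v _ (hmin v hv), if_neg,
      smul_zero]
    exact fun h => hvu (FreeMonoid.toList.injective h.symm)
  · exact fun h => absurd hu h

include hy in
/-- Elements of a free group whose images in the abelianization are part of a dual pair of families
freely generate a free monoid. -/
theorem freeMonoid_lift_injective : Function.Injective (FreeMonoid.lift y) := by
  intro u v huv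
  refine letterAddOne_injective (lift_difference_injective χ y hy ?_)
  rw [lift_difference_letterAddOne, lift_difference_letterAddOne, huv]

end Magnus

/-! ### Existence of a soft noncommutative toric scheme -/

namespace SoftToric

variable {n : ℕ} {Δ : SmoothFan n}

/-- The coordinates of a character with respect to the basis of `M` dual to a basis of `N`. -/
noncomputable def dualCoords (b : Module.Basis (Fin n) ℤ (Fin n → ℤ)) :
    CharLattice n →* Multiplicative (Fin n → ℤ) :=
  AddMonoidHom.toMultiplicative
    { toFun := fun m i => m ⬝ᵥ b i
      map_zero' := by ext i; exact zero_dotProduct _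
      map_add' := fun m m' => by ext i; exact add_dotProduct _ _ _ }

/-- Lifts to the edge-path monoid of the basis of `M` dual to a basis of `N` freely generate a
free monoid. -/
theorem freeMonoid_lift_injective_of_dualVec (b : Module.Basis (Fin n) ℤ (Fin n → ℤ))
    (y : Fin n → EdgePathMonoid n)
    (hy : ∀ i, edgeProj n (y i) = Multiplicative.ofAdd (dualVec b i)) :
    Function.Injective (FreeMonoid.lift y) := by
  refine Magnus.freeMonoid_lift_injective ((dualCoords b).comp (edgeProj n)) y fun i => ?_
  rw [MonoidHom.comp_apply, hy]
  refine congrArg Multiplicative.ofAdd (funext fun j => ?_)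
  refine (dualVec_dotProduct_basis b i j).trans ?_
  rw [Pi.single_apply]
  simp only [eq_comm]

theorem pairing_sum_dotProduct (b : Module.Basis (Fin n) ℤ (Fin n → ℤ)) (u : Fin n → ℤ)
    (v : Fin n → ℝ) :
    pairing u v = ∑ j, ((u ⬝ᵥ b j : ℤ) : ℝ) * pairing (dualVec b j) v := by
  conv_lhs => rw [← sum_dotProduct_smul_dualVec b u]
  simp only [pairing, Finset.mul_sum, Finset.sum_apply, Pi.smul_apply, smul_eq_mul, Int.cast_sum,
    Int.cast_mul, Finset.sum_mul, mul_assoc]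
  exact Finset.sum_comm

variable (y : {σ : Δ.Cone // IsMax σ} → Fin n → EdgePathMonoid n)

/-- Generators for the monoid of the cone `τ`: the chosen words of the maximal cones containing
`τ`, their inverses so far as their characters are invertible on `U_τ`, and all letters
when `τ` is the zero cone. -/
def coneGenerators (τ : Δ.Cone) : Set (EdgePathMonoid n) :=
  {p | (∃ (σ : {σ : Δ.Cone // IsMax σ}) (i : Fin n), τ ≤ σ.1 ∧
      (p = y σ i ∨ p = (y σ i)⁻¹ ∧ edgeProj n p ∈ dualMonoid τ.1)) ∨
    τ.1 = ⊥ ∧ ∃ i, p = FreeGroup.of i ∨ p = (FreeGroup.of i)⁻¹}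

theorem coneGenerators_finite (τ : Δ.Cone) : (coneGenerators y τ).Finite := by
  have : Finite Δ.Cone := Δ.finite
  refine (((Set.finite_range fun q : {σ : Δ.Cone // IsMax σ} × Fin n => y q.1 q.2).union
    (Set.finite_range fun q : {σ : Δ.Cone // IsMax σ} × Fin n => (y q.1 q.2)⁻¹)).union
    ((Set.finite_range fun i : Fin n => FreeGroup.of i).union
      (Set.finite_range fun i : Fin n => (FreeGroup.of i)⁻¹))).subset ?_
  rintro p (⟨σ, i, -, rfl | ⟨rfl, -⟩⟩ | ⟨-, i, rfl | rfl⟩)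
  · exact Or.inl (Or.inl ⟨(σ, i), rfl⟩)
  · exact Or.inl (Or.inr ⟨(σ, i), rfl⟩)
  · exact Or.inr (Or.inl ⟨i, rfl⟩)
  · exact Or.inr (Or.inr ⟨i, rfl⟩)

theorem coneGenerators_anti {τ σ : Δ.Cone} (h : τ ≤ σ) :
    coneGenerators y σ ⊆ coneGenerators y τ := by
  rintro p (⟨μ, i, hμ, hp⟩ | ⟨hσ, hp⟩)
  · exact Or.inl ⟨μ, i, h.trans hμ, hp.imp_right fun hp => ⟨hp.1, dualMonoid_anti h hp.2⟩⟩
  · exact Or.inr ⟨le_bot_iff.1 ((show τ.1 ≤ σ.1 from h).trans_eq hσ), hp⟩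

theorem closure_coneGenerators_of_eq_bot {τ : Δ.Cone} (hτ : τ.1 = ⊥) :
    Submonoid.closure (coneGenerators y τ) = ⊤ := by
  refine top_le_iff.1 fun p _ => ?_
  induction p using FreeGroup.induction_on with
  | C1 => exact one_mem _
  | of i => exact Submonoid.subset_closure (Or.inr ⟨hτ, i, Or.inl rfl⟩)
  | inv_of i _ => exact Submonoid.subset_closure (Or.inr ⟨hτ, i, Or.inr rfl⟩)
  | mul p q hp hq => exact mul_mem (hp trivial) (hq trivial)

theorem mem_dualMonoid_bot (m : CharLattice n) :
    m ∈ dualMonoid (⊥ : PointedCone ℝ (Fin n → ℝ)) := fun v hv => by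
  rw [(Submodule.mem_bot _).1 hv, pairing_zero_right]

variable (b : {σ : Δ.Cone // IsMax σ} → Module.Basis (Fin n) ℤ (Fin n → ℤ))
  (hb : ∀ σ, σ.1.1 = basisCone (b σ))
  (hy : ∀ σ i, edgeProj n (y σ i) = Multiplicative.ofAdd (dualVec (b σ) i))

include hb hy

theorem edgeProj_mem_dualMonoid (σ : {σ : Δ.Cone // IsMax σ}) (i : Fin n) :
    edgeProj n (y σ i) ∈ dualMonoid σ.1.1 := by
  rw [hb, mem_dualMonoid_basisCone]
  intro j
  rw [hy, toAdd_ofAdd, dualVec_dotProduct_basis]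
  split_ifs <;> norm_num

theorem edgeProj_mem_of_mem_coneGenerators {τ : Δ.Cone} {p : EdgePathMonoid n}
    (hp : p ∈ coneGenerators y τ) : edgeProj n p ∈ dualMonoid τ.1 := by
  obtain ⟨σ, i, hσ, rfl | hp⟩ | ⟨hτ, -⟩ := hp
  · exact dualMonoid_anti hσ (edgeProj_mem_dualMonoid y b hb hy σ i)
  · exact hp.2
  · rw [hτ]; exact mem_dualMonoid_bot _

omit hb hy in
theorem inv_mem_coneGenerators {τ : Δ.Cone} {p : EdgePathMonoid n}
    (hp : p ∈ coneGenerators y τ) (h : (edgeProj n p)⁻¹ ∈ dualMonoid τ.1) :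
    p⁻¹ ∈ coneGenerators y τ := by
  obtain ⟨σ, i, hσ, rfl | ⟨rfl, -⟩⟩ | ⟨hτ, i, rfl | rfl⟩ := hp
  · exact Or.inl ⟨σ, i, hσ, Or.inr ⟨rfl, by rwa [map_inv]⟩⟩
  · exact Or.inl ⟨σ, i, hσ, Or.inl (inv_inv _)⟩
  · exact Or.inr ⟨hτ, i, Or.inr rfl⟩
  · exact Or.inr ⟨hτ, i, Or.inl (inv_inv _)⟩

/-- The characters generated by the chosen words exhaust `M_τ`. -/
theorem dualMonoid_le_map_closure_coneGenerators (τ : Δ.Cone) :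
    dualMonoid τ.1 ≤ (Submonoid.closure (coneGenerators y τ)).map (edgeProj n) := by
  intro m hm
  obtain ⟨σ, hτσ, hσ⟩ := SmoothFan.exists_isMax_ge τ
  set μ : {σ : Δ.Cone // IsMax σ} := ⟨σ, hσ⟩
  set P := (Submonoid.closure (coneGenerators y τ)).map (edgeProj n)
  have hgen (i : Fin n) : Multiplicative.ofAdd (dualVec (b μ) i) ∈ P :=
    ⟨y μ i, Submonoid.subset_closure (Or.inl ⟨μ, i, hτσ, Or.inl rfl⟩), hy μ i⟩
  have hinv (i : Fin n) (h : (Multiplicative.ofAdd (dualVec (b μ) i))⁻¹ ∈ dualMonoid τ.1) :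
      (Multiplicative.ofAdd (dualVec (b μ) i))⁻¹ ∈ P := by
    refine ⟨(y μ i)⁻¹, Submonoid.subset_closure
      (Or.inl ⟨μ, i, hτσ, Or.inr ⟨rfl, ?_⟩⟩), ?_⟩
    · rwa [map_inv, hy]
    · rw [map_inv, hy]
  have hprod (a : CharLattice n) :
      a = ∏ i, Multiplicative.ofAdd (dualVec (b μ) i) ^ (a.toAdd ⬝ᵥ b μ i) := by
    conv_lhs => rw [← ofAdd_toAdd a, ← sum_dotProduct_smul_dualVec (b μ) a.toAdd, ofAdd_sum]
    rfl
  have hmem (a : CharLattice n) (ha : a ∈ dualMonoid σ.1) : a ∈ P := by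
    rw [show σ.1 = basisCone (b μ) from hb μ, mem_dualMonoid_basisCone] at ha
    rw [hprod a]
    refine Submonoid.prod_mem _ fun i _ => ?_
    obtain ⟨k, hk⟩ := Int.eq_ofNat_of_zero_le (ha i)
    rw [hk, zpow_natCast]
    exact pow_mem (hgen i) k
  -- If `u` cuts out `τ` in `σ`, then `m + k • u` lies in `M_σ` for some `k`. It remains to invert
  -- `u` in `P`.
  obtain ⟨u, hu⟩ := Δ.exists_cutsOut hτσ
  obtain ⟨S, hS⟩ := Δ.rational _ σ.2
  obtain ⟨k, hk⟩ := exists_nsmul_add_mem hu hS hm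
  have hu0 (i : Fin n) : 0 ≤ u ⬝ᵥ b μ i := by
    refine (mem_dualMonoid_basisCone (b μ) (m := Multiplicative.ofAdd u)).1 ?_ i
    rw [← hb]
    exact hu.1
  -- `u` is a nonnegative combination of dual basis vectors that are nonnegative on `σ`. It vanishes
  -- on `τ`, so every vector with positive coefficient vanishes there too, and the inverses of these
  -- are among the generators.
  have huinv : (Multiplicative.ofAdd u)⁻¹ ∈ P := by
    rw [hprod (Multiplicative.ofAdd u), ← Finset.prod_inv_distrib]
    refine Submonoid.prod_mem _ fun i _ => ?_
    rw [toAdd_ofAdd]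
    obtain ⟨l, hl⟩ := Int.eq_ofNat_of_zero_le (hu0 i)
    rw [hl, zpow_natCast, ← inv_pow]
    obtain rfl | hl0 := Nat.eq_zero_or_pos l
    · rw [pow_zero]; exact one_mem _
    refine pow_mem (hinv i fun v hv => ?_) l
    have hvσ : v ∈ σ.1 := hτσ hv
    have hv0 : pairing u v = 0 := (hu.2 v hvσ).1 hv
    have hnn (j : Fin n) : 0 ≤ pairing (dualVec (b μ) j) v := by
      have := edgeProj_mem_dualMonoid y b hb hy μ j
      rw [hy] at this
      exact this v hvσ
    have hsum : ∑ j, ((u ⬝ᵥ b μ j : ℤ) : ℝ) * pairing (dualVec (b μ) j) v = 0 := by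
      rw [← hv0, ← pairing_sum_dotProduct (b μ)]
    have h0 := (Finset.sum_eq_zero_iff_of_nonneg fun j _ =>
      mul_nonneg (Int.cast_nonneg (hu0 j)) (hnn j)).1 hsum i (Finset.mem_univ i)
    rw [hl, Int.cast_natCast, mul_eq_zero, Nat.cast_eq_zero] at h0
    change 0 ≤ pairing (-dualVec (b μ) i) v
    rw [pairing_neg_left, h0.resolve_left hl0.ne', neg_zero]
  have h := mul_mem (hmem (Multiplicative.ofAdd (m.toAdd + k • u)) hk) (pow_mem huinv k)
  rw [ofAdd_add, ofAdd_toAdd, ofAdd_nsmul, mul_assoc, ← mul_pow, mul_inv_cancel, one_pow,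
    mul_one] at h
  exact h

theorem coneGenerators_of_isMax (σ : {σ : Δ.Cone // IsMax σ}) (hσ : σ.1.1 ≠ ⊥) :
    coneGenerators y σ.1 = Set.range (y σ) := by
  refine Set.Subset.antisymm ?_ ?_
  · rintro p (⟨μ, i, hμ, hp⟩ | ⟨h, -⟩)
    · obtain rfl : σ = μ := Subtype.ext (σ.2.eq_of_le hμ)
      obtain rfl | ⟨rfl, hp⟩ := hp
      · exact ⟨i, rfl⟩
      · rw [hb, mem_dualMonoid_basisCone] at hp
        have := hp i
        rw [map_inv, hy, ← ofAdd_neg, toAdd_ofAdd, neg_dotProduct, dualVec_dotProduct_basis,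
          if_pos rfl] at this
        norm_num at this
    · exact absurd h hσ
  · rintro _ ⟨i, rfl⟩
    exact Or.inl ⟨σ, i, le_rfl, Or.inl rfl⟩

theorem nonempty_closure_coneGenerators_equiv (σ : {σ : Δ.Cone // IsMax σ}) :
    Nonempty (Submonoid.closure (coneGenerators y σ.1) ≃* FreeMonoid (Fin n)) := by
  by_cases hσ : σ.1.1 = ⊥
  · have hn : IsEmpty (Fin n) := ⟨fun i => by
      have h := latticeVec_mem_basisCone (b σ) i
      rw [← hb, hσ, Submodule.mem_bot] at h
      refine (b σ).ne_zero i (funext fun j => ?_)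
      exact Int.cast_eq_zero.1 (congrFun h j)⟩
    have h1 : Subsingleton (FreeGroup (Fin n)) := inferInstance
    have h2 : Subsingleton (FreeMonoid (Fin n)) := inferInstanceAs (Subsingleton (List (Fin n)))
    exact ⟨{
      toFun := 1
      invFun := 1
      left_inv := fun _ => Subsingleton.elim _ _
      right_inv := fun _ => Subsingleton.elim _ _
      map_mul' := fun _ _ => Subsingleton.elim _ _ }⟩
  · rw [coneGenerators_of_isMax y b hb hy σ hσ, ← FreeMonoid.mrange_lift]
    exact ⟨(MulEquiv.ofBijective (FreeMonoid.lift (y σ)).mrangeRestrict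
      ⟨fun u v h => freeMonoid_lift_injective_of_dualVec (b σ) (y σ) (hy σ)
        (congrArg Subtype.val h), MonoidHom.mrangeRestrict_surjective _⟩).symm⟩

/-- The soft noncommutative toric scheme generated by lifts of the bases of the dual monoids of the
maximal cones. -/
def SoftScheme.ofLifts : SoftScheme Δ where
  monoid τ := Submonoid.closure (coneGenerators y τ)
  anti h := Submonoid.closure_mono (coneGenerators_anti y h)
  admissible τ := by
    refine ⟨⟨(coneGenerators_finite y τ).toFinset, by simp⟩, le_antisymm ?_
      (dualMonoid_le_map_closure_coneGenerators y b hb hy τ), inv_mem_closure_of_generators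
        (fun _ => edgeProj_mem_of_mem_coneGenerators y b hb hy)
        fun _ hp h => Submonoid.subset_closure (inv_mem_coneGenerators y hp h)⟩
    rw [Submonoid.map_le_iff_le_comap]
    exact Submonoid.closure_le.2 fun _ => edgeProj_mem_of_mem_coneGenerators y b hb hy
  free_of_isMax σ hσ := nonempty_closure_coneGenerators_equiv y b hb hy ⟨σ, hσ⟩
  zero_eq_top _ hτ := closure_coneGenerators_of_eq_bot y hτ

omit hb hy in
theorem SoftScheme.nonempty (Δ : SmoothFan n) : Nonempty (SoftScheme Δ) := by
  choose b hb using fun σ : {σ : Δ.Cone // IsMax σ} => SmoothFan.exists_eq_basisCone σ.2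
  choose y hy using fun (σ : {σ : Δ.Cone // IsMax σ}) (i : Fin n) =>
    edgeProj_surjective (Multiplicative.ofAdd (dualVec (b σ) i))
  exact ⟨.ofLifts y b hb hy⟩

end SoftToric

theorem proposition3p5 {n : ℕ} (Δ : SoftToric.SmoothFan n)
    (L : Δ.toricVariety.Modules) (hL : SoftToric.IsInvertibleSheaf L) :
    (∀ Y : SoftToric.SoftScheme Δ, ∃ Y' : SoftToric.SoftScheme Δ, Y'.IsSoftening Y ∧
      ∃ E : SoftToric.LeftModule Y', E.IsInvertible ∧ E.Extends L) ∧
    (∃ (Y : SoftToric.SoftScheme Δ) (E : SoftToric.LeftModule Y),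
      E.IsInvertible ∧ E.Extends L) := by
  refine ⟨fun Y => Y.exists_softening_extends hL, ?_⟩
  obtain ⟨Y⟩ := SoftToric.SoftScheme.nonempty Δ
  obtain ⟨Y', -, E, hE⟩ := Y.exists_softening_extends hL
  exact ⟨Y', E, hE⟩
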